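/- Let $A$ be an alphabet of $n$ letters, $B$ an alphabet of at most $n$ letters, $k\ge 2$, $\varphi\colon A^*\to A^*$ a $k$-uniform morphism (i.e. $|\varphi(b)|=k$ for all $b\in A$), $h\colon A\to B$ a coding, and $s\in A$ a letter with which $\varphi(s)$ begins. Then $\varphi^\infty(s)=\lim_{l}\varphi^l(s)$ is an infinite sequence and $h(\varphi^\infty(s))$ is a $k$-automatic sequence. A sequence $x$ is almost periodic if for every non-empty word $u$ that occurs in $x$ there is $l$ such that every subword of $x$ of length $l$ contains an occurrence of $u$. For $l\in\mathbb N$ and $b,c\in A$ write $b\sim_l c$ if $h(\varphi^l(b))=h(\varphi^l(c))$. Let $B_n$ be the number of equivalence relations on a set of $n$ elements. The square of a directed graph has the same vertices, with an edge from $x$ to $y$ whenever the graph has a path of length $2$ from $x$ to $y$. Let $G_0$ be the graph on $A$ with an edge from $b$ to each letter occurring in $\varphi(b)$, let $T_0$ be the graph on the unordered pairs of distinct letters with an edge from $\{b,c\}$ to each $\{\varphi(b)(j),\varphi(c)(j)\}$, $1\le j\le k$, with $\varphi(b)(j)\ne\varphi(c)(j)$, and let $G_{i+1}$, $T_{i+1}$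 be the squares of $G_i$, $T_i$. Then the following hold. 1. For all $i,l$ and all $b\neq c$ in $A$: $b\sim_{l+2^i}c$ if and only if $x\sim_l y$ for all $\{x,y\}$ to which $T_i$ has an edge from $\{b,c\}$. In particular, $b\sim_{2^i}c$ if and only if $h(x)=h(y)$ for all these $\{x,y\}$. 2. For all $i$ and all $b,c\in A$: $G_i$ has an edge from $b$ to $c$ if and only if $c$ occurs in $\varphi^{2^i}(b)$. 3. For every $H\subseteq A$: there is $m$ such that every word $\varphi^m(b)$, $b\in A$, contains a letter of $H$, if and only if in $G_{n^2+1}$ every $b\in A$ has an edge to some letter of $H$. 4. If every letter of $A$ occurs in $\varphi^\infty(s)$, then for every $r\ge B_n$ the sequence $h(\varphi^\infty(s))$ is almost periodic if and only if there is $m$ such that every word $\varphi^m(b)$, $b\in A$, contains a letter $c\sim_r s$. 5. There are a function $r\colon\mathbb N\to\mathbb N$ with $2^{r(n)}\ge B_n$ for all $n$ and an algorithm that, given $(A,B,k,\varphi,h,s)$, computes the set of all $b\in A$ with $b\sim_{2^{r(n)}}s$ in time polynomial in $n$ and $k$. 6. There is an algorithm that, given $(A,B,k,\varphi,h,s)$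 and a set $H\subseteq A$, decides in time polynomial in $n$ and $k$ whether there is $m$ such that every word $\varphi^m(b)$, $b\in A$, contains a letter of $H$. 7. There is an algorithm that, given $(A,B,k,\varphi,h,s)$, decides in time polynomial in $n$ and $k$ whether $h(\varphi^\infty(s))$ is almost periodic. In 5–7 the algorithms are programs for a random access machine with addition and truncated subtraction of natural numbers, at unit cost per elementary operation, for which polynomial time is the same as polynomial time on Turing machines. The morphism and the coding are given by their tables of values. -/

import Mathlib

/-! ### Words, morphisms, morphic sequences -/

/-- A morphism `A* → B*`, given by its values `φ b` on the letters, applied to a word. -/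
def applyMorphism {A B : Type*} (φ : A → List B) (u : List A) : List B :=
  u.flatMap φ

/-- The word `φ^l(u)`. -/
def iterMorphism {A : Type*} (φ : A → List A) (l : ℕ) (u : List A) : List A :=
  (applyMorphism φ)^[l] u

/-- The infinite sequence `φ^∞(s) = lim φ^l(s)`, for `φ` prolongable on `s`. In that case
`φ^l(s)` has more than `l` letters and is a prefix of `φ^(l+1)(s)`, so that the `i`-th letter of
the limit is the `i`-th letter of `φ^i(s)`; the default value of `getD` is never used. -/
def limitSequence {A : Type*} (φ : A → List A) (s : A) (i : ℕ) : A :=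
  (iterMorphism φ i [s]).getD i s

/-- The subword `x(i) x(i+1) ... x(i+l-1)` of length `l` of a sequence. -/
def subword {B : Type*} (x : ℕ → B) (i l : ℕ) : List B :=
  (List.range l).map fun j => x (i + j)

/-- `u` is a factor of `x`: a nonempty word that occurs in `x`. -/
def IsFactor {B : Type*} (u : List B) (x : ℕ → B) : Prop :=
  u ≠ [] ∧ ∃ i, subword x i u.length = u

/-- `x` is almost periodic: for every factor `u` there is `l` such that every subword of `x` of
length `l` contains an occurrence of `u`. -/
def AlmostPeriodic {B : Type*} (x : ℕ → B) : Prop :=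
  ∀ u, IsFactor u x → ∃ l, ∀ i, u <:+: subword x i l

/-! ### Automatic sequences given by finite data -/

/-- Finite data of a `k`-automatic sequence: an alphabet `A` of `n` letters, an alphabet `B` of
`m ≤ n` letters, a `k`-uniform morphism `φ : A* → A*`, a coding `h : A → B`, and a letter `s`
which begins `φ(s)`. For `k`-uniform `φ`, prolongability on `s` means `2 ≤ k`. -/
structure AutomaticData where
  n : ℕ
  k : ℕ
  m : ℕ
  two_le_k : 2 ≤ k
  m_le_n : m ≤ n
  φ : Fin n → List (Fin n)
  h : Fin n → Fin m
  s : Fin n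
  uniform : ∀ b, (φ b).length = k
  starts : ∃ u, φ s = s :: u

namespace AutomaticData

variable (I : AutomaticData)

/-- The `k`-automatic sequence `h(φ^∞(s))`. -/
def sequence : ℕ → Fin I.m := fun i => I.h (limitSequence I.φ I.s i)

/-- Every letter of the alphabet occurs in `φ^∞(s)`. -/
def AllLettersOccur : Prop := ∀ b : Fin I.n, ∃ i, limitSequence I.φ I.s i = b

/-- `b ∼_l c`: the words `h(φ^l(b))` and `h(φ^l(c))` are equal. -/
def Sim (l : ℕ) (b c : Fin I.n) : Prop :=
  (iterMorphism I.φ l [b]).map I.h = (iterMorphism I.φ l [c]).map I.h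

/-- For some `m`, each of the words `φ^m(b)`, `b ∈ A`, contains a letter of `H`. -/
def EventuallyMeets (H : Set (Fin I.n)) : Prop :=
  ∃ m, ∀ b, ∃ c ∈ iterMorphism I.φ m [b], c ∈ H

/-- The graph of the morphism: an edge from `b` to each letter occurring in `φ(b)`. -/
def letterGraph (b c : Fin I.n) : Prop := c ∈ I.φ b

/-- The graph `T₀` on the unordered pairs of distinct letters: an edge from `{b, c}` to each
`{φ(b)(j), φ(c)(j)}` with `φ(b)(j) ≠ φ(c)(j)`. -/
def pairGraph (p q : Sym2 (Fin I.n)) : Prop :=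
  ¬ p.IsDiag ∧ ¬ q.IsDiag ∧
    ∃ b c, p = s(b, c) ∧ q ∈ List.zipWith (fun x y => s(x, y)) (I.φ b) (I.φ c)

end AutomaticData

/-- The square of a directed graph: edges are the paths of length two. -/
def squareGraph {V : Type*} (E : V → V → Prop) (x y : V) : Prop :=
  ∃ z, E x z ∧ E z y

/-! ### Random access machines with unit cost

A program is a finite object built from assignments, truncated subtraction and addition of
natural numbers (no multiplication), indirect reading and writing of the memory, conditionals and
loops. Each elementary operation and each test takes one step. One step adds at most one bit
to the longest number stored, and polynomial time in this model is polynomial time for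
Turing machines. -/

/-- Contents of the registers (addressed by constants of the program) and of the memory
(addressed by the contents of registers). -/
structure RamState where
  reg : ℕ → ℕ
  mem : ℕ → ℕ

/-- Write `v` into register `r`. -/
def RamState.setReg (σ : RamState) (r v : ℕ) : RamState :=
  { σ with reg := Function.update σ.reg r v }

/-- Write `v` into the memory cell with address `a`. -/
def RamState.setMem (σ : RamState) (a v : ℕ) : RamState :=
  { σ with mem := Function.update σ.mem a v }

/-- The starting state on input `w`: the list `w` in the memory from address `0` on, and `0`
everywhere else. -/
def RamState.start (w : List ℕ) : RamState where
  reg := fun _ => 0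
  mem := fun i => w.getD i 0

inductive RamProg where
  /-- `reg r := c` -/
  | const (r c : ℕ)
  /-- `reg r := reg a` -/
  | copy (r a : ℕ)
  /-- `reg r := reg a + reg b` -/
  | add (r a b : ℕ)
  /-- `reg r := max (reg a - reg b) 0` -/
  | sub (r a b : ℕ)
  /-- `reg r := mem (reg a)` -/
  | read (r a : ℕ)
  /-- `mem (reg a) := reg b` -/
  | write (a b : ℕ)
  /-- first `p`, then `q` -/
  | seq (p q : RamProg)
  /-- if `reg r ≠ 0` then `p` else `q` -/
  | cond (r : ℕ) (p q : RamProg)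
  /-- while `reg r ≠ 0` do `p` -/
  | loop (r : ℕ) (p : RamProg)

/-- `p.Runs σ t τ`: started in the state `σ`, the program `p` halts after exactly `t` steps, in
the state `τ`. -/
inductive RamProg.Runs : RamProg → RamState → ℕ → RamState → Prop where
  | const (r c : ℕ) (σ : RamState) : Runs (.const r c) σ 1 (σ.setReg r c)
  | copy (r a : ℕ) (σ : RamState) : Runs (.copy r a) σ 1 (σ.setReg r (σ.reg a))
  | add (r a b : ℕ) (σ : RamState) : Runs (.add r a b) σ 1 (σ.setReg r (σ.reg a + σ.reg b))
  | sub (r a b : ℕ) (σ : RamState) : Runs (.sub r a b) σ 1 (σ.setReg r (σ.reg a - σ.reg b))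
  | read (r a : ℕ) (σ : RamState) : Runs (.read r a) σ 1 (σ.setReg r (σ.mem (σ.reg a)))
  | write (a b : ℕ) (σ : RamState) : Runs (.write a b) σ 1 (σ.setMem (σ.reg a) (σ.reg b))
  | seq {p q : RamProg} {σ σ' τ : RamState} {t t' : ℕ} :
      Runs p σ t σ' → Runs q σ' t' τ → Runs (.seq p q) σ (t + t') τ
  | cond_true {r : ℕ} {p q : RamProg} {σ τ : RamState} {t : ℕ} :
      σ.reg r ≠ 0 → Runs p σ t τ → Runs (.cond r p q) σ (t + 1) τ
  | cond_false {r : ℕ} {p q : RamProg} {σ τ : RamState} {t : ℕ} :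
      σ.reg r = 0 → Runs q σ t τ → Runs (.cond r p q) σ (t + 1) τ
  | loop_stop {r : ℕ} {p : RamProg} {σ : RamState} :
      σ.reg r = 0 → Runs (.loop r p) σ 1 σ
  | loop_step {r : ℕ} {p : RamProg} {σ σ' τ : RamState} {t t' : ℕ} :
      σ.reg r ≠ 0 → Runs p σ t σ' → Runs (.loop r p) σ' t' τ →
        Runs (.loop r p) σ (t + t' + 1) τ

/-- One program solves all instances `x : ι`: on the input word `input x` it halts within a number
of steps bounded by a fixed polynomial in `size x`, in a state that is a correct answer for `x`. -/
def SolvableInPolyTime {ι : Type*} (input : ι → List ℕ) (size : ι → ℕ)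
    (correct : ι → RamState → Prop) : Prop :=
  ∃ (P : RamProg) (f : Polynomial ℕ), ∀ x, ∃ t τ,
    P.Runs (RamState.start (input x)) t τ ∧ t ≤ f.eval (size x) ∧ correct x τ

/-- `v` is the truth value of `p`: `1` if `p` holds and `0` if not. -/
def IsTruthValue (v : ℕ) (p : Prop) : Prop :=
  (p → v = 1) ∧ (¬ p → v = 0)

/-- The input word `n, k, m, s`, then the `n` words `φ(b)` (each of length `k`), then the `n`
values `h(b)`. Letters are the numbers from `0`. -/
def AutomaticData.input (I : AutomaticData) : List ℕ :=
  [I.n, I.k, I.m, I.s] ++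
    (List.finRange I.n).flatMap (fun b => (I.φ b).map Fin.val) ++
    (List.finRange I.n).map (fun b => (I.h b : ℕ))

/-- The membership table of a set `H` of letters: `n` numbers, `1` for the elements of `H` and
`0` for the other letters. -/
def membershipTable {n : ℕ} (H : Finset (Fin n)) : List ℕ :=
  (List.finRange n).map fun b => if b ∈ H then 1 else 0

/-! ### Iterated morphisms -/

/-! The common source of all bounds is pigeonhole: a sequence in a finite set in which each term
determines the next takes its value at `r` again at arbitrarily large indices, as soon as `r` is at
least the size of the set (`exists_ge_eq_of_succ_determined`). It is applied to the sets of letters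
`b` for which `φ^m(b)` meets `H`, to the sets of letters of `φ^m(s)`, and to the equivalence
relations `∼_l`.

Since `φ` is uniform, the images of two letters can be compared position by position, and iterating
`φ` on two letters is the same as iterating one morphism on pairs. Hence `b ∼_(l+l') c` means that
all pairs below `(b, c)` at depth `l'` are related by `∼_l`. Squaring a graph doubles the depth,
which gives the statements on `T_i` and `G_i`.

For the criterion, `φ^∞(s)` is cut into blocks `φ^r(c)`; a letter `c ∼_r s` marks an occurrence of
the prefix of length `k^r` at a multiple of `k^r`. Almost periodicity gives such occurrences with
bounded gaps, because the residues modulo `K` at which long prefixes occur are closed under addition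
and so under negation (`AlmostPeriodic.exists_gap_dvd`). Conversely, `∼_r` equals some `∼_l` with
`l` as large as desired, so the marked letters produce arbitrarily long prefixes with bounded gaps.

For the algorithms, `n^2` squarings of the graph on ordered pairs reach depth `2^(n^2)`, which is at
least the number of equivalence relations and at least the number of sets of letters. The diagonal
pairs carry the graph of `φ` itself, so one final table answers every question. The programs are
written in a language whose loops are bounded by variables, so that polynomial running time follows
by structural induction. -/

theorem iterMorphism_zero {A : Type*} (φ : A → List A) (u : List A) :
    iterMorphism φ 0 u = u := rfl

theorem iterMorphism_succ {A : Type*} (φ : A → List A) (l : ℕ) (u : List A) :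
    iterMorphism φ (l + 1) u = (iterMorphism φ l u).flatMap φ :=
  Function.iterate_succ_apply' _ _ _

theorem iterMorphism_one {A : Type*} (φ : A → List A) (a : A) :
    iterMorphism φ 1 [a] = φ a := by
  simp [iterMorphism_succ, iterMorphism_zero]

theorem iterMorphism_add {A : Type*} (φ : A → List A) (l l' : ℕ) (u : List A) :
    iterMorphism φ (l + l') u = iterMorphism φ l (iterMorphism φ l' u) :=
  Function.iterate_add_apply _ _ _ _

theorem iterMorphism_eq_flatMap {A : Type*} (φ : A → List A) (l : ℕ) (u : List A) :
    iterMorphism φ l u = u.flatMap fun a => iterMorphism φ l [a] := by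
  induction l with
  | zero => simp [iterMorphism_zero]
  | succ l ih => simp only [iterMorphism_succ]; rw [ih, List.flatMap_assoc]

theorem mem_iterMorphism_add {A : Type*} (φ : A → List A) (l l' : ℕ) (p q : A) :
    q ∈ iterMorphism φ (l + l') [p] ↔
      ∃ z ∈ iterMorphism φ l' [p], q ∈ iterMorphism φ l [z] := by
  rw [iterMorphism_add, iterMorphism_eq_flatMap, List.mem_flatMap]

theorem length_iterMorphism {A : Type*} {φ : A → List A} {k : ℕ} (hφ : ∀ b, (φ b).length = k)
    (l : ℕ) (u : List A) : (iterMorphism φ l u).length = u.length * k ^ l := by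
  induction l with
  | zero => simp [iterMorphism_zero]
  | succ l ih =>
    simp [iterMorphism_succ, List.length_flatMap, hφ, ih, pow_succ, mul_assoc]

theorem getElem?_flatMap_of_uniform {A B : Type*} {f : A → List B} {K : ℕ}
    (hf : ∀ a, (f a).length = K) (u : List A) (i j : ℕ) (hj : j < K) :
    (u.flatMap f)[i * K + j]? = u[i]?.bind fun a => (f a)[j]? := by
  induction u generalizing i with
  | nil => simp
  | cons a u ih =>
    cases i with
    | zero => simp [List.getElem?_append_left, hf, hj]
    | succ i =>
      have : (i + 1) * K + j = (f a).length + (i * K + j) := by rw [hf]; ring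
      rw [List.flatMap_cons, this, List.getElem?_append_right (by omega)]
      simp [ih]

theorem squareGraph_iterate_iff {A : Type*} (φ : A → List A) (i : ℕ) (p q : A) :
    squareGraph^[i] (fun p q => q ∈ φ p) p q ↔ q ∈ iterMorphism φ (2 ^ i) [p] := by
  induction i generalizing p q with
  | zero => simp [iterMorphism_one]
  | succ i ih =>
    rw [Function.iterate_succ_apply', pow_succ, mul_two, mem_iterMorphism_add]
    simp [squareGraph, ih]

/-! ### Pairs of words of equal length -/

/-- The morphism `(b, c) ↦ φ(b) × φ(c)` on the alphabet of pairs. -/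
def pairMorphism {A : Type*} (φ : A → List A) (p : A × A) : List (A × A) :=
  (φ p.1).zip (φ p.2)

/-- Uniformity keeps the blocks of the two concatenations aligned. -/
theorem zip_flatMap {A B : Type*} {f : A → List B} {K : ℕ} (hf : ∀ a, (f a).length = K)
    (u v : List A) :
    (u.flatMap f).zip (v.flatMap f) = (u.zip v).flatMap fun p => (f p.1).zip (f p.2) := by
  induction u generalizing v with
  | nil => simp
  | cons a u ih =>
    cases v with
    | nil => simp
    | cons b v =>
      simp only [List.flatMap_cons, List.zip_cons_cons]
      rw [List.zip_append (by simp [hf]), ih]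

theorem iterMorphism_pairMorphism {A : Type*} {φ : A → List A} {k : ℕ}
    (hφ : ∀ b, (φ b).length = k) (l : ℕ) (b c : A) :
    iterMorphism (pairMorphism φ) l [(b, c)] =
      (iterMorphism φ l [b]).zip (iterMorphism φ l [c]) := by
  induction l with
  | zero => simp [iterMorphism_zero]
  | succ l ih =>
    rw [iterMorphism_succ, iterMorphism_succ, iterMorphism_succ, zip_flatMap hφ, ih]
    rfl

theorem map_eq_map_iff_forall_mem_zip {A B : Type*} (h : A → B) (u v : List A)
    (huv : u.length = v.length) :
    u.map h = v.map h ↔ ∀ p ∈ u.zip v, h p.1 = h p.2 := by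
  induction u generalizing v with
  | nil => cases v <;> simp_all
  | cons a u ih =>
    cases v with
    | nil => simp at huv
    | cons b v =>
      simp only [List.length_cons, Nat.add_right_cancel_iff] at huv
      simp [ih v huv]

theorem mem_zip_swap {A : Type*} (u v : List A) (x y : A) :
    (x, y) ∈ u.zip v ↔ (y, x) ∈ v.zip u := by
  rw [← List.zip_swap v u, List.mem_map]
  constructor
  · rintro ⟨⟨a, b⟩, h, e⟩
    cases e
    exact h
  · exact fun h => ⟨(y, x), h, rfl⟩

theorem mem_zip_self {A : Type*} (u : List A) (x y : A) :
    (x, y) ∈ u.zip u ↔ x ∈ u ∧ x = y := by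
  induction u with
  | nil => simp
  | cons a u ih => simp only [List.zip_cons_cons, List.mem_cons, ih, Prod.mk.injEq]; grind

/-! ### Eventually periodic orbits in finite types -/

/-- A sequence in a finite type in which each term determines the next one returns to each of its
terms of index at least the number of elements. -/
theorem exists_ge_eq_of_succ_determined {α : Type*} [Finite α] {f : ℕ → α}
    (hf : ∀ a b, f a = f b → f (a + 1) = f (b + 1)) {r : ℕ} (hr : Nat.card α ≤ r) (L : ℕ) :
    ∃ l, L ≤ l ∧ f l = f r := by
  have shift : ∀ a b d, f a = f b → f (a + d) = f (b + d) := by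
    intro a b d h
    induction d with
    | zero => exact h
    | succ d ih => exact hf _ _ ih
  -- Pigeonhole on the `r + 1` terms of index at most `r`. Both indices are at most `r`, so `r`
  -- already lies in the periodic part, with period `y - x`.
  obtain ⟨x, y, hxy, e⟩ : ∃ x y : Fin (r + 1), x ≠ y ∧ f x = f y := by
    by_contra! H
    have hi : Function.Injective fun x : Fin (r + 1) => f x := fun x y e => by
      by_contra hne
      exact H x y hne e
    have := Nat.card_le_card_of_injective _ hi
    simp at this
    omega
  wlog hlt : x < y generalizing x y
  · exact this y x hxy.symm e.symm (lt_of_le_of_ne (not_lt.1 hlt) hxy.symm)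
  obtain ⟨p, hp⟩ : ∃ p, (y : ℕ) = x + p := ⟨y - x, by have := Fin.lt_def.1 hlt; omega⟩
  have hp0 : 0 < p := by have := Fin.lt_def.1 hlt; omega
  have hstep : f (r + p) = f r := by
    have h1 := shift x y (r - x) e
    have h2 : (x : ℕ) + (r - x) = r := by omega
    have h3 : (y : ℕ) + (r - x) = r + p := by omega
    rw [h2, h3] at h1
    exact h1.symm
  have hall : ∀ q, f (r + q * p) = f r := by
    intro q
    induction q with
    | zero => simp
    | succ q ih =>
      have := shift (r + p) r (q * p) hstep
      rw [show r + (q + 1) * p = r + p + q * p by ring, this, ih]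
  exact ⟨r + L * p, by nlinarith, hall L⟩

/-! ### The relations `∼_l` and the graph of pairs -/

namespace AutomaticData

variable (I : AutomaticData)

theorem length_iter (l : ℕ) (b : Fin I.n) : (iterMorphism I.φ l [b]).length = I.k ^ l := by
  simp [length_iterMorphism I.uniform]

theorem iter_ne_nil (l : ℕ) (b : Fin I.n) : iterMorphism I.φ l [b] ≠ [] := by
  intro h
  have := I.length_iter l b
  rw [h] at this
  have := pow_pos (lt_of_lt_of_le two_pos I.two_le_k) l
  simp_all

theorem sim_iff (l : ℕ) (b c : Fin I.n) :
    I.Sim l b c ↔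
      ∀ p ∈ iterMorphism (pairMorphism I.φ) l [(b, c)], I.h p.1 = I.h p.2 := by
  rw [iterMorphism_pairMorphism I.uniform, Sim,
    map_eq_map_iff_forall_mem_zip _ _ _ (by simp [length_iter])]

theorem sim_refl (l : ℕ) (b : Fin I.n) : I.Sim l b b := rfl

theorem sim_symm {l : ℕ} {b c : Fin I.n} (h : I.Sim l b c) : I.Sim l c b := Eq.symm h

/-- With `l' = 2^i` this is the source of the statement on `T_i`; with `l' = 1` it shows that `∼_l`
determines `∼_(l+1)`. -/
theorem sim_add_iff (l l' : ℕ) (b c : Fin I.n) :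
    I.Sim (l + l') b c ↔
      ∀ p ∈ iterMorphism (pairMorphism I.φ) l' [(b, c)], I.Sim l p.1 p.2 := by
  simp only [sim_iff, mem_iterMorphism_add]
  exact ⟨fun h z hz p hp => h p ⟨z, hz, hp⟩, fun h p ⟨z, hz, hp⟩ => h z hz p hp⟩

theorem mem_pair_swap {l : ℕ} {b c x y : Fin I.n} :
    (x, y) ∈ iterMorphism (pairMorphism I.φ) l [(b, c)] ↔
      (y, x) ∈ iterMorphism (pairMorphism I.φ) l [(c, b)] := by
  rw [iterMorphism_pairMorphism I.uniform, iterMorphism_pairMorphism I.uniform, mem_zip_swap]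

theorem mem_pair_diag {l : ℕ} {b x y : Fin I.n} :
    (x, y) ∈ iterMorphism (pairMorphism I.φ) l [(b, b)] ↔
      x ∈ iterMorphism I.φ l [b] ∧ x = y := by
  rw [iterMorphism_pairMorphism I.uniform, mem_zip_self]

theorem pairGraph_iff (b c x y : Fin I.n) :
    I.pairGraph s(b, c) s(x, y) ↔ b ≠ c ∧ x ≠ y ∧
      ((x, y) ∈ pairMorphism I.φ (b, c) ∨ (y, x) ∈ pairMorphism I.φ (b, c)) := by
  simp only [pairGraph, Sym2.mk_isDiag_iff, ← ne_eq]
  refine and_congr_right fun _ => and_congr_right fun _ => ?_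
  have key : ∀ u v : List (Fin I.n), s(x, y) ∈ List.zipWith (fun x y => s(x, y)) u v ↔
      (x, y) ∈ u.zip v ∨ (y, x) ∈ u.zip v := by
    intro u v
    rw [← List.map_uncurry_zip_eq_zipWith, List.mem_map]
    constructor
    · rintro ⟨⟨a, d⟩, hm, e⟩
      rcases Sym2.eq_iff.1 e with ⟨rfl, rfl⟩ | ⟨rfl, rfl⟩
      · exact .inl hm
      · exact .inr hm
    · rintro (h | h)
      · exact ⟨_, h, rfl⟩
      · exact ⟨_, h, Sym2.eq_swap⟩
  constructor
  · rintro ⟨b', c', e, hm⟩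
    rw [key] at hm
    rcases Sym2.eq_iff.1 e with ⟨rfl, rfl⟩ | ⟨rfl, rfl⟩
    · exact hm
    · exact hm.symm.imp (mem_zip_swap _ _ _ _).1 (mem_zip_swap _ _ _ _).1
  · exact fun h => ⟨b, c, rfl, (key _ _).2 h⟩

/-- Orientation can be forgotten because the morphism on pairs commutes with swapping. Omitting the
diagonal loses no path between off-diagonal pairs, since only diagonal pairs lie below a diagonal
pair. -/
theorem squareGraph_iterate_pairGraph_iff (i : ℕ) (b c x y : Fin I.n) :
    squareGraph^[i] I.pairGraph s(b, c) s(x, y) ↔ b ≠ c ∧ x ≠ y ∧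
      ((x, y) ∈ iterMorphism (pairMorphism I.φ) (2 ^ i) [(b, c)] ∨
        (y, x) ∈ iterMorphism (pairMorphism I.φ) (2 ^ i) [(b, c)]) := by
  induction i generalizing b c x y with
  | zero => simp [iterMorphism_one, pairGraph_iff]
  | succ i ih =>
    rw [Function.iterate_succ_apply', pow_succ, mul_two]
    simp only [mem_iterMorphism_add, squareGraph]
    constructor
    · rintro ⟨z, h1, h2⟩
      induction z using Sym2.inductionOn with
      | hf u v =>
      rw [ih] at h1 h2
      refine ⟨h1.1, h2.2.1, ?_⟩
      rcases h1.2.2 with h1 | h1 <;> rcases h2.2.2 with h2 | h2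
      · exact .inl ⟨_, h1, h2⟩
      · exact .inr ⟨_, h1, h2⟩
      · exact .inr ⟨_, h1, I.mem_pair_swap.1 h2⟩
      · exact .inl ⟨_, h1, I.mem_pair_swap.1 h2⟩
    · rintro ⟨hbc, hxy, ⟨⟨u, v⟩, h1, h2⟩ | ⟨⟨u, v⟩, h1, h2⟩⟩ <;> refine ⟨s(u, v), ?_⟩
      all_goals
        -- A path that enters the diagonal cannot leave it, and its end is off the diagonal.
        have huv : u ≠ v := by
          rintro rfl
          have := (I.mem_pair_diag.1 h2).2
          simp_all
        rw [ih, ih]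
        simp_all

theorem sim_add_two_pow_iff (i l : ℕ) (b c : Fin I.n) (hbc : b ≠ c) :
    I.Sim (l + 2 ^ i) b c ↔
      ∀ x y : Fin I.n, squareGraph^[i] I.pairGraph s(b, c) s(x, y) → I.Sim l x y := by
  simp only [squareGraph_iterate_pairGraph_iff, sim_add_iff]
  constructor
  · rintro h x y ⟨-, -, hm | hm⟩
    · exact h _ hm
    · exact I.sim_symm (h _ hm)
  · rintro h ⟨x, y⟩ hm
    by_cases hxy : x = y
    · subst hxy
      exact I.sim_refl _ _
    · exact h x y ⟨hbc, hxy, .inl hm⟩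

/-- On a set `D` of letters closed under `φ`, words `φ^m(b)` that all meet `H` exist for some `m`
only if they all meet `H` for every `m` that is at least the number of sets of letters. -/
theorem exists_meets_iff (D H : Set (Fin I.n)) (hD : ∀ b ∈ D, ∀ c ∈ I.φ b, c ∈ D) {N : ℕ}
    (hN : 2 ^ I.n ≤ N) :
    (∃ m, ∀ b ∈ D, ∃ c ∈ iterMorphism I.φ m [b], c ∈ H) ↔
      ∀ b ∈ D, ∃ c ∈ iterMorphism I.φ N [b], c ∈ H := by
  refine ⟨?_, fun h => ⟨N, h⟩⟩
  rintro ⟨m, hm⟩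
  let f : ℕ → Set (Fin I.n) := fun m => {b | ∃ c ∈ iterMorphism I.φ m [b], c ∈ H}
  have hsucc : ∀ m, f (m + 1) = {b | ∃ z ∈ I.φ b, z ∈ f m} := by
    intro m
    ext b
    simp only [f, Set.mem_ofPred_eq, mem_iterMorphism_add, iterMorphism_one]
    grind
  -- Once all of `D` meets `H` at depth `m`, it does so at every greater depth: `φ(b)` is nonempty
  -- and stays in `D`. It then suffices that the set `f N` recurs beyond `m`.
  have hmono : ∀ d, D ⊆ f (m + d) := by
    intro d
    induction d with
    | zero => exact hm
    | succ d ih =>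
      intro b hb
      rw [← add_assoc, hsucc]
      obtain ⟨z, hz⟩ := List.exists_mem_of_ne_nil _ (I.iter_ne_nil 1 b)
      rw [iterMorphism_one] at hz
      exact ⟨z, hz, ih (hD b hb z hz)⟩
  obtain ⟨l, hl, e⟩ := exists_ge_eq_of_succ_determined (f := f)
    (fun a b e => by rw [hsucc, hsucc, e]) (r := N) (by simpa [Nat.card_eq_fintype_card]) m
  intro b hb
  have := hmono (l - m) hb
  rw [Nat.add_sub_cancel' hl, e] at this
  exact this

theorem eventuallyMeets_iff (H : Set (Fin I.n)) {N : ℕ} (hN : 2 ^ I.n ≤ N) :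
    I.EventuallyMeets H ↔ ∀ b, ∃ c ∈ iterMorphism I.φ N [b], c ∈ H := by
  simpa [EventuallyMeets] using I.exists_meets_iff Set.univ H (by simp) hN

end AutomaticData

/-! ### Almost periodic sequences -/

theorem length_subword {B : Type*} (x : ℕ → B) (i l : ℕ) : (subword x i l).length = l := by
  simp [subword]

theorem subword_eq_iff {B : Type*} (x : ℕ → B) (i j l : ℕ) :
    subword x i l = subword x j l ↔ ∀ t < l, x (i + t) = x (j + t) := by
  simp [subword]

theorem infix_subword_iff {B : Type*} (x : ℕ → B) (u : List B) (i l : ℕ) :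
    u <:+: subword x i l ↔ ∃ j, i ≤ j ∧ j + u.length ≤ i + l ∧ subword x j u.length = u := by
  constructor
  · rintro ⟨v, w, e⟩
    have hlen := congrArg List.length e
    simp only [List.length_append, length_subword] at hlen
    refine ⟨i + v.length, by omega, by omega, List.ext_getElem (length_subword _ _ _) ?_⟩
    intro t h1 h2
    have h3 : (v ++ u ++ w)[v.length + t]? = some u[t] := by
      rw [List.append_assoc, List.getElem?_append_right (by omega)]
      simp [List.getElem?_append_left h2]
    rw [e] at h3
    simp only [subword, List.getElem?_map, Option.map_eq_some_iff] at h3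
    obtain ⟨a, ha, hb⟩ := h3
    rw [List.getElem?_range (by omega)] at ha
    cases ha
    simp [subword, ← hb, add_assoc]
  · rintro ⟨j, h1, h2, e⟩
    obtain ⟨p, rfl⟩ := Nat.exists_eq_add_of_le h1
    obtain ⟨q, hq⟩ := Nat.exists_eq_add_of_le h2
    have hl : l = p + u.length + q := by omega
    refine ⟨subword x i p, subword x (i + p + u.length) q, ?_⟩
    rw [hl]
    nth_rw 1 [← e]
    simp [subword, List.range_add, add_assoc, Function.comp_def]

/-- The prefix of length `L` of an almost periodic sequence occurs with bounded gaps. -/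
theorem AlmostPeriodic.exists_gap {B : Type*} {x : ℕ → B} (hx : AlmostPeriodic x) {L : ℕ}
    (hL : 0 < L) : ∃ W, ∀ i, ∃ j, i ≤ j ∧ j < i + W ∧ ∀ t < L, x (j + t) = x t := by
  obtain ⟨W, hW⟩ := hx (subword x 0 L) ⟨by
    intro h
    have := congrArg List.length h
    simp only [length_subword, List.length_nil] at this
    omega, 0, by rw [length_subword]⟩
  refine ⟨W, fun i => ?_⟩
  obtain ⟨j, h1, h2, e⟩ := (infix_subword_iff _ _ _ _).1 (hW i)
  rw [length_subword] at h2 e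
  rw [subword_eq_iff] at e
  exact ⟨j, h1, by omega, by simpa using e⟩

/-- The prefix of length `L` of an almost periodic sequence occurs with bounded gaps at the
multiples of `K`. -/
theorem AlmostPeriodic.exists_gap_dvd {B : Type*} {x : ℕ → B} (hx : AlmostPeriodic x) {K : ℕ}
    (hK : 0 < K) (L : ℕ) :
    ∃ W, ∀ i, ∃ j, i ≤ j ∧ j < i + W ∧ K ∣ j ∧ ∀ t < L, x (j + t) = x t := by
  classical
  let Occ : ℕ → ℕ → Prop := fun L j => ∀ t < L, x (j + t) = x t
  have occ_mono : ∀ {L L' j}, L ≤ L' → Occ L' j → Occ L j :=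
    fun h ho t ht => ho t (lt_of_lt_of_le ht h)
  -- The residues modulo `K` of the occurrences of the prefix of length `L`.
  let R : ℕ → Finset ℕ := fun L => (Finset.range K).filter fun a => ∃ j, j % K = a ∧ Occ L j
  have memR : ∀ L a, a ∈ R L ↔ ∃ j, j % K = a ∧ Occ L j := by
    intro L a
    simp only [R, Finset.mem_filter, Finset.mem_range, and_iff_right_iff_imp]
    rintro ⟨j, rfl, -⟩
    exact Nat.mod_lt _ hK
  have R_anti : ∀ {L L'}, L ≤ L' → R L' ⊆ R L := by
    intro L L' h a ha
    obtain ⟨j, hj, ho⟩ := (memR _ _).1 ha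
    exact (memR _ _).2 ⟨j, hj, occ_mono h ho⟩
  -- The sets `R L` decrease, so they are constant from a length of least cardinality on. Starting
  -- at `L + 1` makes the prefix nonempty, as `exists_gap` requires.
  obtain ⟨L₀, hL₀, hmin⟩ : ∃ L₀, L + 1 ≤ L₀ ∧ ∀ L', L₀ ≤ L' → R L' = R L₀ := by
    have hex : ∃ c, ∃ L₀, L + 1 ≤ L₀ ∧ (R L₀).card = c := ⟨_, L + 1, le_rfl, rfl⟩
    obtain ⟨L₀, h1, h2⟩ := Nat.find_spec hex
    refine ⟨L₀, h1, fun L' h => Finset.eq_of_subset_of_card_le (R_anti h) ?_⟩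
    rw [h2]
    exact Nat.find_min' hex ⟨L', h1.trans h, rfl⟩
  -- Every residue in `R L₀` is attained by an occurrence at position at most `D`, hence inside the
  -- prefix of length `D + L₀`. So it can be copied to every occurrence of that longer prefix.
  obtain ⟨D, hD⟩ : ∃ D, ∀ a ∈ R L₀, ∃ j ≤ D, j % K = a ∧ Occ L₀ j := by
    have : ∀ a, ∃ j, a ∈ R L₀ → j % K = a ∧ Occ L₀ j := by
      intro a
      by_cases ha : a ∈ R L₀
      · obtain ⟨j, hj⟩ := (memR _ _).1 ha
        exact ⟨j, fun _ => hj⟩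
      · exact ⟨0, fun h => absurd h ha⟩
    choose g hg using this
    exact ⟨(R L₀).sup g, fun a ha => ⟨g a, Finset.le_sup ha, hg a ha⟩⟩
  have shift : ∀ {j j'}, Occ (D + L₀) j → j' ≤ D → Occ L₀ j' → Occ L₀ (j + j') := by
    intro j j' h1 h2 h3 t ht
    rw [add_assoc, h1 _ (by omega), h3 t ht]
  -- By stability the residue `a` is also attained by the prefix of length `D + L₀`; the occurrence
  -- with residue `b` inside this copy has residue `a + b`.
  have hadd : ∀ a ∈ R L₀, ∀ b ∈ R L₀, (a + b) % K ∈ R L₀ := by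
    intro a ha b hb
    rw [← hmin (D + L₀) (by omega)] at ha
    obtain ⟨j, rfl, ho⟩ := (memR _ _).1 ha
    obtain ⟨j', hj', rfl, ho'⟩ := hD b hb
    exact (memR _ _).2 ⟨j + j', by simp, shift ho hj' ho'⟩
  have hmul : ∀ a ∈ R L₀, ∀ c, (c * a) % K ∈ R L₀ := by
    intro a ha c
    induction c with
    | zero => exact (memR _ _).2 ⟨0, by simp, fun t _ => by simp⟩
    | succ c ih =>
      have := hadd _ ih _ ha
      rwa [Nat.mod_add_mod, ← Nat.succ_mul] at this
  obtain ⟨W, hW⟩ := hx.exists_gap (L := D + L₀) (by omega)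
  refine ⟨W + D, fun i => ?_⟩
  obtain ⟨j, h1, h2, ho⟩ := hW i
  have ha : j % K ∈ R L₀ := by
    rw [← hmin (D + L₀) (by omega)]
    exact (memR _ _).2 ⟨j, rfl, ho⟩
  -- The multiple `(K - 1) * a` is congruent to `-a`, so moving by `j'` inside the long prefix leads
  -- to a multiple of `K`.
  obtain ⟨j', hj', e, ho'⟩ := hD _ (hmul _ ha (K - 1))
  refine ⟨j + j', by omega, by omega, ?_, occ_mono (by omega) (shift ho hj' ho')⟩
  obtain ⟨K, rfl⟩ := Nat.exists_eq_add_of_lt hK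
  simp only [zero_add, Nat.add_sub_cancel] at e ⊢
  have h3 : j + j' ≡ j % (K + 1) + K * (j % (K + 1)) [MOD K + 1] :=
    Nat.ModEq.add (Nat.mod_modEq _ _).symm e
  refine (Nat.modEq_zero_iff_dvd).1 (h3.trans ((Nat.modEq_zero_iff_dvd).2 ⟨j % (K + 1), ?_⟩))
  ring

/-! ### The limit sequence and its blocks -/

namespace AutomaticData

variable (I : AutomaticData)

theorem k_pos : 0 < I.k := lt_of_lt_of_le two_pos I.two_le_k

theorem lt_k_pow (l : ℕ) : l < I.k ^ l := Nat.lt_pow_self I.two_le_k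

theorem iter_prefix_succ (l : ℕ) :
    iterMorphism I.φ l [I.s] <+: iterMorphism I.φ (l + 1) [I.s] := by
  obtain ⟨u, hu⟩ := I.starts
  rw [iterMorphism_add, iterMorphism_one, hu, iterMorphism_eq_flatMap _ _ (_ :: u),
    List.flatMap_cons]
  exact List.prefix_append _ _

theorem iter_prefix {l l' : ℕ} (h : l ≤ l') :
    iterMorphism I.φ l [I.s] <+: iterMorphism I.φ l' [I.s] := by
  induction h with
  | refl => exact List.prefix_refl _
  | step _ ih => exact ih.trans (I.iter_prefix_succ _)

theorem getElem?_iter_s (l i : ℕ) (hi : i < I.k ^ l) :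
    (iterMorphism I.φ l [I.s])[i]? = some (limitSequence I.φ I.s i) := by
  have h1 : i < (iterMorphism I.φ i [I.s]).length := by
    rw [length_iter]
    exact I.lt_k_pow i
  have h2 : (iterMorphism I.φ i [I.s])[i]? = some (limitSequence I.φ I.s i) := by
    rw [limitSequence, List.getD_eq_getElem?_getD, List.getElem?_eq_getElem h1]
    rfl
  have h3 : i < (iterMorphism I.φ l [I.s]).length := by rwa [length_iter]
  rw [← h2]
  rcases le_total l i with h | h
  · obtain ⟨v, hv⟩ := I.iter_prefix h
    rw [← hv, List.getElem?_append_left h3]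
  · obtain ⟨v, hv⟩ := I.iter_prefix h
    rw [← hv, List.getElem?_append_left h1]

theorem limitSequence_zero : limitSequence I.φ I.s 0 = I.s := rfl

/-- The limit is a fixed point of `φ^l`: its `i`-th block of length `k^l` is the image of its `i`-th
letter. This follows from `φ^(l+i)(s) = φ^l(φ^i(s))`, where `i < k^i` ensures that `φ^i(s)` is long
enough. -/
theorem getElem?_iter_limitSequence (l i j : ℕ) (hj : j < I.k ^ l) :
    (iterMorphism I.φ l [limitSequence I.φ I.s i])[j]? =
      some (limitSequence I.φ I.s (i * I.k ^ l + j)) := by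
  have hi := I.lt_k_pow i
  rw [← I.getElem?_iter_s (l + i) (i * I.k ^ l + j), iterMorphism_add,
    iterMorphism_eq_flatMap _ _ (iterMorphism _ _ _), getElem?_flatMap_of_uniform (I.length_iter l) _ _ _ hj, I.getElem?_iter_s i i hi]
  · rfl
  · rw [pow_add]
    nlinarith

/-- The letters that occur in `φ^∞(s)`. -/
def occurring : Set (Fin I.n) := Set.range (limitSequence I.φ I.s)

theorem mem_iter_limitSequence (l i : ℕ) (c : Fin I.n) :
    c ∈ iterMorphism I.φ l [limitSequence I.φ I.s i] ↔
      ∃ j < I.k ^ l, limitSequence I.φ I.s (i * I.k ^ l + j) = c := by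
  rw [List.mem_iff_getElem?]
  constructor
  · rintro ⟨j, hj⟩
    have hlt : j < I.k ^ l := by
      obtain ⟨h, -⟩ := List.getElem?_eq_some_iff.1 hj
      rwa [length_iter] at h
    rw [I.getElem?_iter_limitSequence _ _ _ hlt] at hj
    exact ⟨j, hlt, Option.some_inj.1 hj⟩
  · rintro ⟨j, hj, rfl⟩
    exact ⟨j, I.getElem?_iter_limitSequence _ _ _ hj⟩

theorem occurring_closed : ∀ b ∈ I.occurring, ∀ c ∈ I.φ b, c ∈ I.occurring := by
  rintro _ ⟨i, rfl⟩ c hc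
  rw [← iterMorphism_one I.φ, mem_iter_limitSequence] at hc
  obtain ⟨j, -, rfl⟩ := hc
  exact ⟨_, rfl⟩

/-- The set of letters of `φ^m(s)` determines the next such set, so the one for `N` recurs at some
`l ≥ i`, where `φ^l(s)` is long enough to contain position `i`. -/
theorem mem_occurring_iff (b : Fin I.n) {N : ℕ} (hN : 2 ^ I.n ≤ N) :
    b ∈ I.occurring ↔ b ∈ iterMorphism I.φ N [I.s] := by
  constructor
  · rintro ⟨i, rfl⟩
    let f : ℕ → Set (Fin I.n) := fun m => {b | b ∈ iterMorphism I.φ m [I.s]}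
    have hsucc : ∀ m, f (m + 1) = {b | ∃ z ∈ f m, b ∈ I.φ z} := by
      intro m
      ext b
      simp [f, iterMorphism_succ]
    obtain ⟨l, hl, e⟩ := exists_ge_eq_of_succ_determined (f := f)
      (fun a b e => by rw [hsucc, hsucc, e]) (r := N) (by simpa [Nat.card_eq_fintype_card]) i
    change _ ∈ f N
    rw [← e]
    exact List.mem_of_getElem? (I.getElem?_iter_s l i (lt_of_le_of_lt hl (I.lt_k_pow l)))
  · intro h
    rw [← I.limitSequence_zero, mem_iter_limitSequence] at h
    obtain ⟨j, -, rfl⟩ := h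
    exact ⟨_, rfl⟩

theorem sim_limitSequence_iff (r i i' : ℕ) :
    I.Sim r (limitSequence I.φ I.s i) (limitSequence I.φ I.s i') ↔
      ∀ t < I.k ^ r, I.sequence (i * I.k ^ r + t) = I.sequence (i' * I.k ^ r + t) := by
  rw [Sim, List.ext_getElem?_iff]
  constructor
  · intro h t ht
    have := h t
    rw [List.getElem?_map, List.getElem?_map, I.getElem?_iter_limitSequence _ _ _ ht,
      I.getElem?_iter_limitSequence _ _ _ ht] at this
    exact Option.some_inj.1 this
  · intro h t
    rw [List.getElem?_map, List.getElem?_map]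
    by_cases ht : t < I.k ^ r
    · rw [I.getElem?_iter_limitSequence _ _ _ ht, I.getElem?_iter_limitSequence _ _ _ ht]
      exact congrArg some (h t ht)
    · rw [List.getElem?_eq_none, List.getElem?_eq_none] <;> rw [length_iter] <;> omega

/-- Letters related to `s` are the occurrences of the prefix of length `k^r` at multiples of `k^r`.
-/
theorem sim_s_iff (r i : ℕ) :
    I.Sim r (limitSequence I.φ I.s i) I.s ↔
      ∀ t < I.k ^ r, I.sequence (i * I.k ^ r + t) = I.sequence t := by
  have := I.sim_limitSequence_iff r i 0
  simpa only [zero_mul, zero_add, limitSequence_zero] using this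

/-- For `r` at least the number of equivalence relations on the alphabet, `∼_r` is one of the
relations `∼_l` with `l` arbitrarily large. -/
theorem exists_ge_sim_iff {r : ℕ} (hr : Nat.card (Setoid (Fin I.n)) ≤ r) (L : ℕ) :
    ∃ l, L ≤ l ∧ ∀ b c, I.Sim l b c ↔ I.Sim r b c := by
  let f : ℕ → Setoid (Fin I.n) := fun l =>
    Setoid.ker fun b => (iterMorphism I.φ l [b]).map I.h
  have hf : ∀ l b c, (f l) b c ↔ I.Sim l b c := fun _ _ _ => Iff.rfl
  have : Finite (Setoid (Fin I.n)) :=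
    Finite.of_injective (fun s : Setoid (Fin I.n) => s.r) fun s t h =>
      Setoid.ext fun a b => iff_of_eq (congrFun (congrFun h a) b)
  obtain ⟨l, hl, e⟩ := exists_ge_eq_of_succ_determined (f := f) (fun a b e => by
    ext c d
    rw [hf, hf, sim_add_iff, sim_add_iff]
    simp only [← hf]
    rw [e]) hr L
  exact ⟨l, hl, fun b c => by rw [← hf, e, hf]⟩

/-- The criterion of almost periodicity, for the letters that occur. -/
theorem almostPeriodic_iff {r : ℕ} (hr : Nat.card (Setoid (Fin I.n)) ≤ r) :
    AlmostPeriodic I.sequence ↔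
      ∃ m, ∀ b ∈ I.occurring, ∃ c ∈ iterMorphism I.φ m [b], c ∈ {c | I.Sim r c I.s} := by
  have kpos : ∀ l, 0 < I.k ^ l := fun l => pow_pos I.k_pos l
  constructor
  · intro hx
    obtain ⟨W, hW⟩ := hx.exists_gap_dvd (kpos r) (I.k ^ r)
    -- The gap serves as the exponent too: since `W < k^W`, the next aligned occurrence of the
    -- prefix after the start of the image of the `i`-th letter falls among the `k^W` letters of
    -- `φ^W` of that letter.
    refine ⟨W, ?_⟩
    rintro _ ⟨i, rfl⟩
    obtain ⟨j, h1, h2, ⟨j, rfl⟩, h3⟩ := hW (I.k ^ r * (i * I.k ^ W))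
    have h4 := Nat.le_of_mul_le_mul_left h1 (kpos r)
    have h5 : j < i * I.k ^ W + I.k ^ W := by
      have := I.lt_k_pow W
      have := kpos r
      by_contra hc
      have h6 : I.k ^ r * (i * I.k ^ W + I.k ^ W) ≤ I.k ^ r * j :=
        Nat.mul_le_mul_left _ (not_lt.1 hc)
      nlinarith
    refine ⟨limitSequence I.φ I.s j, (I.mem_iter_limitSequence _ _ _).2
      ⟨j - i * I.k ^ W, by omega, by congr 1; omega⟩, ?_⟩
    refine (I.sim_s_iff _ _).2 fun t ht => ?_
    rw [mul_comm, h3 t ht]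
  · rintro ⟨m, hm⟩ u ⟨hu, i, hi⟩
    -- As `k^l > l`, the occurrence of `u` at `i` lies within the prefix of length `k^l`.
    obtain ⟨l, hl, hsim⟩ := I.exists_ge_sim_iff hr (i + u.length)
    -- A window of length `2K` contains a whole aligned block of length `K`, namely the one with
    -- number `i₀ / K + 1`.
    refine ⟨2 * I.k ^ (m + l), fun i₀ => (infix_subword_iff _ _ _ _).2 ?_⟩
    set K := I.k ^ (m + l) with hK
    have hKp : 0 < K := kpos _
    obtain ⟨c, hc, hcs⟩ := hm (limitSequence I.φ I.s (i₀ / K + 1)) ⟨_, rfl⟩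
    obtain ⟨j, hj, rfl⟩ := (I.mem_iter_limitSequence _ _ _).1 hc
    replace hcs := (I.sim_s_iff _ _).1 ((hsim _ _).2 hcs)
    have hll := I.lt_k_pow l
    have e : ((i₀ / K + 1) * I.k ^ m + j) * I.k ^ l = i₀ / K * K + K + j * I.k ^ l := by
      rw [hK, pow_add]
      ring
    have h1 : (j + 1) * I.k ^ l ≤ K := by
      rw [hK, pow_add]
      exact Nat.mul_le_mul_right _ hj
    have h2 := Nat.div_add_mod' i₀ K
    have h3 := Nat.mod_lt i₀ hKp
    rw [add_mul, one_mul] at h1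
    rw [e] at hcs
    refine ⟨i₀ / K * K + K + j * I.k ^ l + i, by omega, by omega, ?_⟩
    rw [← hi, length_subword, subword_eq_iff]
    intro t ht
    rw [add_assoc, hcs _ (by omega)]

theorem almostPeriodic_iff_eventuallyMeets (h : I.AllLettersOccur) {r : ℕ}
    (hr : Nat.card (Setoid (Fin I.n)) ≤ r) :
    AlmostPeriodic I.sequence ↔ I.EventuallyMeets {c | I.Sim r c I.s} := by
  rw [I.almostPeriodic_iff hr]
  exact exists_congr fun m => ⟨fun H b => H b (h b), fun H b _ => H b⟩

end AutomaticData

/-! ### A language of bounded sums over loops, compiled to random access machines -/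

/-- Expressions over variables and the memory; `sum v p e` is the sum of `e` over all values of
the variable `v` below the value of the variable `p`, and `ite a b c` tests whether `a` is
nonzero. -/
inductive Exp where
  | const (c : ℕ)
  | var (v : ℕ)
  | add (a b : Exp)
  | sub (a b : Exp)
  | load (a : Exp)
  | ite (a b c : Exp)
  | sum (v p : ℕ) (e : Exp)

/-- Commands that write to the memory; `down v p c` executes `c` for all values of the variable `v`
below the value of the variable `p`, in decreasing order. -/
inductive Cmd where
  | store (a e : Exp)
  | seq (c d : Cmd)
  | down (v p : ℕ) (c : Cmd)

/-- Apply `f (N - 1)`, …, `f 1`, `f 0` in this order. -/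
def iterDown {α : Type*} (f : ℕ → α → α) : ℕ → α → α
  | 0, x => x
  | N + 1, x => iterDown f N (f N x)

open Function in
def Exp.eval : Exp → (ℕ → ℕ) → (ℕ → ℕ) → ℕ
  | const c, _, _ => c
  | var v, ρ, _ => ρ v
  | add a b, ρ, m => a.eval ρ m + b.eval ρ m
  | sub a b, ρ, m => a.eval ρ m - b.eval ρ m
  | load a, ρ, m => m (a.eval ρ m)
  | ite a b c, ρ, m => if a.eval ρ m ≠ 0 then b.eval ρ m else c.eval ρ m
  | sum v p e, ρ, m => ∑ j ∈ Finset.range (ρ p), e.eval (update ρ v j) m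

open Function in
def Cmd.exec : Cmd → (ℕ → ℕ) → (ℕ → ℕ) → (ℕ → ℕ)
  | store a e, ρ, m => update m (a.eval ρ m) (e.eval ρ m)
  | seq c d, ρ, m => d.exec ρ (c.exec ρ m)
  | down v p c, ρ, m => iterDown (fun j m => c.exec (update ρ v j) m) (ρ p) m

/-- The variable `v` is kept in register `2v + 1`, intermediate results in the even registers;
the value is left in register `2d`. -/
def Exp.compile : Exp → ℕ → RamProg
  | const c, d => .const (2 * d) c
  | var v, d => .copy (2 * d) (2 * v + 1)
  | add a b, d => .seq (a.compile d) (.seq (b.compile (d + 1)) (.add (2 * d) (2 * d) (2 * (d + 1))))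
  | sub a b, d => .seq (a.compile d) (.seq (b.compile (d + 1)) (.sub (2 * d) (2 * d) (2 * (d + 1))))
  | load a, d => .seq (a.compile d) (.read (2 * d) (2 * d))
  | ite a b c, d => .seq (a.compile d) (.cond (2 * d) (b.compile d) (c.compile d))
  | sum v p e, d =>
    .seq (.const (2 * d) 0) <| .seq (.copy (2 * (d + 1)) (2 * p + 1)) <|
    .seq (.copy (2 * (d + 2)) (2 * v + 1)) <|
    .seq (.loop (2 * (d + 1)) <|
      .seq (.const (2 * (d + 3)) 1) <| .seq (.sub (2 * (d + 1)) (2 * (d + 1)) (2 * (d + 3))) <|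
      .seq (.copy (2 * v + 1) (2 * (d + 1))) <| .seq (e.compile (d + 3))
      (.add (2 * d) (2 * d) (2 * (d + 3))))
    (.copy (2 * v + 1) (2 * (d + 2)))

def Cmd.compile : Cmd → ℕ → RamProg
  | store a e, d => .seq (a.compile d) (.seq (e.compile (d + 1)) (.write (2 * d) (2 * (d + 1))))
  | seq c c', d => .seq (c.compile d) (c'.compile d)
  | down v p c, d =>
    .seq (.copy (2 * d) (2 * p + 1)) <| .seq (.copy (2 * (d + 1)) (2 * v + 1)) <|
    .seq (.loop (2 * d) <|
      .seq (.const (2 * (d + 2)) 1) <| .seq (.sub (2 * d) (2 * d) (2 * (d + 2))) <|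
      .seq (.copy (2 * v + 1) (2 * d)) (c.compile (d + 2)))
    (.copy (2 * v + 1) (2 * (d + 1)))

/-- A bound of the running time, in terms of a bound of the variables. -/
noncomputable def Exp.cost : Exp → Polynomial ℕ
  | const _ => 1
  | var _ => 1
  | add a b => a.cost + b.cost + 1
  | sub a b => a.cost + b.cost + 1
  | load a => a.cost + 1
  | ite a b c => a.cost + b.cost + c.cost + 1
  | sum _ _ e => Polynomial.X * (e.cost + 5) + 5

noncomputable def Cmd.cost : Cmd → Polynomial ℕ
  | store a e => a.cost + e.cost + 1
  | seq c d => c.cost + d.cost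
  | down _ _ c => Polynomial.X * (c.cost + 4) + 4

/-! ### Correctness and running time of compiled programs -/

namespace RamState

/-- The values of the variables. -/
def vars (σ : RamState) (v : ℕ) : ℕ := σ.reg (2 * v + 1)

/-- The intermediate results. -/
def tmp (σ : RamState) (d : ℕ) : ℕ := σ.reg (2 * d)

variable (σ : RamState) (r v a x : ℕ)

@[simp] theorem vars_setReg_even : (σ.setReg (2 * r) x).vars = σ.vars := by
  funext v
  simp only [vars, setReg]
  rw [Function.update_of_ne (by omega)]

@[simp] theorem vars_setReg_odd :
    (σ.setReg (2 * r + 1) x).vars = Function.update σ.vars r x := by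
  funext v
  simp only [vars, setReg, Function.update_apply]
  congr 1
  simp

@[simp] theorem tmp_setReg_odd : (σ.setReg (2 * r + 1) x).tmp = σ.tmp := by
  funext v
  simp only [tmp, setReg]
  rw [Function.update_of_ne (by omega)]

@[simp] theorem tmp_setReg_even :
    (σ.setReg (2 * r) x).tmp = Function.update σ.tmp r x := by
  funext v
  simp only [tmp, setReg, Function.update_apply]
  congr 1
  simp

@[simp] theorem mem_setReg : (σ.setReg r x).mem = σ.mem := rfl

@[simp] theorem vars_setMem : (σ.setMem a x).vars = σ.vars := rfl

@[simp] theorem tmp_setMem : (σ.setMem a x).tmp = σ.tmp := rfl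

@[simp] theorem mem_setMem : (σ.setMem a x).mem = Function.update σ.mem a x := rfl

theorem reg_even : σ.reg (2 * r) = σ.tmp r := rfl

theorem reg_odd : σ.reg (2 * r + 1) = σ.vars r := rfl

end RamState

/-- Started in `σ`, the program halts after at most `T` steps in a state with property `Q`. -/
def RamProg.Reaches (p : RamProg) (T : ℕ) (σ : RamState) (Q : RamState → Prop) : Prop :=
  ∃ t τ, p.Runs σ t τ ∧ t ≤ T ∧ Q τ

namespace RamProg

variable {p q : RamProg} {T T' : ℕ} {σ : RamState} {Q Q' : RamState → Prop}

theorem Reaches.mono (h : p.Reaches T σ Q) (hT : T ≤ T') (hQ : ∀ τ, Q τ → Q' τ) :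
    p.Reaches T' σ Q' := by
  obtain ⟨t, τ, h1, h2, h3⟩ := h
  exact ⟨t, τ, h1, h2.trans hT, hQ _ h3⟩

theorem Reaches.seq (h : p.Reaches T σ fun τ => q.Reaches T' τ Q) :
    (RamProg.seq p q).Reaches (T + T') σ Q := by
  obtain ⟨t, τ, h1, h2, t', τ', h3, h4, h5⟩ := h
  exact ⟨_, _, .seq h1 h3, by omega, h5⟩

theorem reaches_const (r c : ℕ) (h : Q (σ.setReg r c)) : (RamProg.const r c).Reaches 1 σ Q :=
  ⟨_, _, .const r c σ, le_rfl, h⟩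

theorem reaches_copy (r a : ℕ) (h : Q (σ.setReg r (σ.reg a))) :
    (RamProg.copy r a).Reaches 1 σ Q :=
  ⟨_, _, .copy r a σ, le_rfl, h⟩

theorem reaches_add (r a b : ℕ) (h : Q (σ.setReg r (σ.reg a + σ.reg b))) :
    (RamProg.add r a b).Reaches 1 σ Q :=
  ⟨_, _, .add r a b σ, le_rfl, h⟩

theorem reaches_sub (r a b : ℕ) (h : Q (σ.setReg r (σ.reg a - σ.reg b))) :
    (RamProg.sub r a b).Reaches 1 σ Q :=
  ⟨_, _, .sub r a b σ, le_rfl, h⟩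

theorem reaches_read (r a : ℕ) (h : Q (σ.setReg r (σ.mem (σ.reg a)))) :
    (RamProg.read r a).Reaches 1 σ Q :=
  ⟨_, _, .read r a σ, le_rfl, h⟩

theorem reaches_write (a b : ℕ) (h : Q (σ.setMem (σ.reg a) (σ.reg b))) :
    (RamProg.write a b).Reaches 1 σ Q :=
  ⟨_, _, .write a b σ, le_rfl, h⟩

theorem reaches_cond (r : ℕ) (h1 : σ.reg r ≠ 0 → p.Reaches T σ Q)
    (h2 : σ.reg r = 0 → q.Reaches T' σ Q) :
    (RamProg.cond r p q).Reaches (T + T' + 1) σ Q := by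
  by_cases h : σ.reg r = 0
  · obtain ⟨t, τ, h3, h4, h5⟩ := h2 h
    exact ⟨_, _, .cond_false h h3, by omega, h5⟩
  · obtain ⟨t, τ, h3, h4, h5⟩ := h1 h
    exact ⟨_, _, .cond_true h h3, by omega, h5⟩

/-- A loop that counts down a register, with an invariant depending on the value of this
register. -/
theorem reaches_loop (r : ℕ) (J : ℕ → RamState → Prop)
    (hJ : ∀ N σ, J N σ → σ.reg r = N)
    (h : ∀ N σ, J (N + 1) σ → p.Reaches T σ (J N)) (N : ℕ) (hσ : J N σ) :
    (RamProg.loop r p).Reaches (N * (T + 1) + 1) σ (J 0) := by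
  induction N generalizing σ with
  | zero => exact ⟨1, σ, by constructor; exact hJ _ _ hσ, by omega, hσ⟩
  | succ N ih =>
    obtain ⟨t, τ, h1, h2, h3⟩ := h N σ hσ
    obtain ⟨t', τ', h4, h5, h6⟩ := ih h3
    exact ⟨_, _, .loop_step (by rw [hJ _ _ hσ]; omega) h1 h4, by
      rw [Nat.succ_mul]
      omega, h6⟩

end RamProg

-- The bound depends on `V` alone because loops are controlled by variables, and a loop variable
-- stays below the value of another variable; the contents of the memory do not matter. Preservation
-- of the intermediate results below `d` is what lets operands, counters and saved variables survive
-- the evaluation of subexpressions.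
open RamProg in
theorem Exp.compile_reaches (e : Exp) (d V : ℕ) (σ : RamState) (hV : ∀ v, σ.vars v ≤ V) :
    (e.compile d).Reaches (e.cost.eval V) σ fun τ =>
      τ.mem = σ.mem ∧ τ.vars = σ.vars ∧ τ.tmp d = e.eval σ.vars σ.mem ∧
        ∀ i < d, τ.tmp i = σ.tmp i := by
  induction e generalizing d σ with
  | const c =>
    refine (reaches_const _ _ ?_).mono (by simp [cost]) fun _ => id
    simp +contextual [eval, Function.update_of_ne, Nat.ne_of_lt]
  | var v =>
    refine (reaches_copy _ _ ?_).mono (by simp [cost]) fun _ => id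
    simp +contextual [eval, Function.update_of_ne, Nat.ne_of_lt, RamState.reg_odd]
  | add a b iha ihb =>
    refine Reaches.mono (.seq (T' := b.cost.eval V + 1) ((iha d σ hV).mono le_rfl ?_))
      (by simp [cost, add_assoc]) fun _ => id
    rintro τ ⟨h1, h2, h3, h4⟩
    refine Reaches.seq ((ihb (d + 1) τ (by rwa [h2])).mono le_rfl ?_)
    rintro τ' ⟨h1', h2', h3', h4'⟩
    refine reaches_add _ _ _ ?_
    rw [RamState.reg_even, RamState.reg_even, h3', h4' d (by omega), h3, h1, h2]
    refine ⟨by simp [h1, h1'], by simp [h2, h2'], by simp [eval], fun i hi => ?_⟩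
    rw [RamState.tmp_setReg_even, Function.update_of_ne (by omega), h4' i (by omega), h4 i hi]
  | sub a b iha ihb =>
    refine Reaches.mono (.seq (T' := b.cost.eval V + 1) ((iha d σ hV).mono le_rfl ?_))
      (by simp [cost, add_assoc]) fun _ => id
    rintro τ ⟨h1, h2, h3, h4⟩
    refine Reaches.seq ((ihb (d + 1) τ (by rwa [h2])).mono le_rfl ?_)
    rintro τ' ⟨h1', h2', h3', h4'⟩
    refine reaches_sub _ _ _ ?_
    rw [RamState.reg_even, RamState.reg_even, h3', h4' d (by omega), h3, h1, h2]
    refine ⟨by simp [h1, h1'], by simp [h2, h2'], by simp [eval], fun i hi => ?_⟩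
    rw [RamState.tmp_setReg_even, Function.update_of_ne (by omega), h4' i (by omega), h4 i hi]
  | load a iha =>
    refine Reaches.mono (.seq (T' := 1) ((iha d σ hV).mono le_rfl ?_)) (by simp [cost]) fun _ => id
    rintro τ ⟨h1, h2, h3, h4⟩
    refine reaches_read _ _ ?_
    rw [RamState.reg_even, h3, h1]
    refine ⟨by simp [h1], by simp [h2], by simp [eval], fun i hi => ?_⟩
    rw [RamState.tmp_setReg_even, Function.update_of_ne (by omega), h4 i hi]
  | ite a b c iha ihb ihc =>
    refine Reaches.mono (.seq (T' := b.cost.eval V + c.cost.eval V + 1) ((iha d σ hV).mono le_rfl ?_))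
      (by simp [cost, add_assoc]) fun _ => id
    rintro τ ⟨h1, h2, h3, h4⟩
    refine (reaches_cond (T := b.cost.eval V) (T' := c.cost.eval V) _ ?_ ?_).mono
      (by omega) fun _ => id
    all_goals
      intro hc
      rw [RamState.reg_even, h3] at hc
    · refine (ihb d τ (by rwa [h2])).mono le_rfl ?_
      rintro τ' ⟨h1', h2', h3', h4'⟩
      exact ⟨by rw [h1', h1], by rw [h2', h2], by rw [h3', h1, h2, eval, if_pos hc],
        fun i hi => by rw [h4' i hi, h4 i hi]⟩
    · refine (ihc d τ (by rwa [h2])).mono le_rfl ?_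
      rintro τ' ⟨h1', h2', h3', h4'⟩
      exact ⟨by rw [h1', h1], by rw [h2', h2],
        by rw [h3', h1, h2, eval, if_neg (not_not.2 hc)],
        fun i hi => by rw [h4' i hi, h4 i hi]⟩
  | sum v p e ih =>
    -- The accumulator plus the sum over the rounds still to come is constant; of the variables only
    -- `v` may have changed, and its old value is kept in `tmp (d + 2)`.
    let J : ℕ → RamState → Prop := fun N τ =>
      τ.mem = σ.mem ∧ N ≤ σ.vars p ∧ Function.update τ.vars v (σ.vars v) = σ.vars ∧
      τ.vars v ≤ V ∧
      τ.tmp (d + 1) = N ∧ τ.tmp (d + 2) = σ.vars v ∧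
      τ.tmp d + ∑ j ∈ Finset.range N, e.eval (Function.update σ.vars v j) σ.mem =
        (Exp.sum v p e).eval σ.vars σ.mem ∧ ∀ i < d, τ.tmp i = σ.tmp i
    have step : ∀ N τ, J (N + 1) τ →
        (RamProg.seq (.const (2 * (d + 3)) 1) <|
          .seq (.sub (2 * (d + 1)) (2 * (d + 1)) (2 * (d + 3))) <|
          .seq (.copy (2 * v + 1) (2 * (d + 1))) <| .seq (e.compile (d + 3))
          (.add (2 * d) (2 * d) (2 * (d + 3)))).Reaches (1 + (1 + (1 + (e.cost.eval V + 1))))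
          τ (J N) := by
      rintro N τ ⟨h1, h2, h3, h3', h4, h5, h6, h7⟩
      refine .seq (reaches_const _ _ (.seq (reaches_sub _ _ _ (.seq (reaches_copy _ _
        (.seq ?_))))))
      simp only [RamState.reg_even]
      have hvars : Function.update τ.vars v N = Function.update σ.vars v N := by
        rw [← h3, Function.update_idem]
      set τ₁ := (((τ.setReg (2 * (d + 3)) 1).setReg (2 * (d + 1)) _).setReg (2 * v + 1) _)
        with hτ₁
      have hv1 : τ₁.vars = Function.update σ.vars v N := by
        simp [hτ₁, h4, hvars]
      have ht1 : ∀ i ≠ d + 1, i ≠ d + 3 → τ₁.tmp i = τ.tmp i := by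
        intro i hi hi'
        simp [hτ₁, hi, hi']
      have ht2 : τ₁.tmp (d + 1) = N := by
        simp [hτ₁, h4]
      have hm1 : τ₁.mem = σ.mem := by simp [hτ₁, h1]
      have hN : N ≤ V := by
        have := hV p
        omega
      refine (ih (d + 3) τ₁ ?_).mono le_rfl ?_
      · intro w
        rw [hv1]
        by_cases hw : w = v
        · subst hw
          simpa using hN
        · rw [Function.update_of_ne hw]
          exact hV w
      rintro τ' ⟨g1, g2, g3, g4⟩
      refine reaches_add _ _ _ ?_
      simp only [RamState.reg_even]
      refine ⟨by simp [g1, hm1], by omega, by simp [g2, hv1], by simpa [g2, hv1] using hN,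
        ?_, ?_, ?_, fun i hi => ?_⟩
      · rw [RamState.tmp_setReg_even, Function.update_of_ne (by omega), g4 _ (by omega), ht2]
      · rw [RamState.tmp_setReg_even, Function.update_of_ne (by omega), g4 _ (by omega),
          ht1 _ (by omega) (by omega), h5]
      · rw [RamState.tmp_setReg_even, Function.update_self, g3, g4 _ (by omega),
          ht1 _ (by omega) (by omega), hv1, hm1, ← h6, Finset.sum_range_succ]
        ring
      · rw [RamState.tmp_setReg_even, Function.update_of_ne (by omega), g4 _ (by omega),
          ht1 _ (by omega) (by omega), h7 i hi]
    refine Reaches.mono (.seq (reaches_const _ _ (.seq (reaches_copy _ _ (.seq (reaches_copy _ _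
      (.seq ((reaches_loop _ J (fun N τ h => h.2.2.2.2.1) step (σ.vars p) ?_).mono le_rfl
        fun τ h => reaches_copy _ _ ?_)))))))) ?_ fun _ => id
    · refine ⟨rfl, le_rfl, by simp, by simpa using hV v, by simp [RamState.reg_odd],
        by simp [RamState.reg_odd], by simp [eval], fun i hi => ?_⟩
      simp only [RamState.tmp_setReg_even]
      rw [Function.update_of_ne (by omega), Function.update_of_ne (by omega),
        Function.update_of_ne (by omega)]
    · obtain ⟨h1, -, h3, -, -, h5, h6, h7⟩ := h
      refine ⟨by simp [h1], by simp [RamState.reg_even, h5, h3], by simpa using h6, ?_⟩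
      simpa using h7
    -- Each round takes five steps besides those of `e`, one of them the test of the loop; five more
    -- steps are spent outside the rounds, including the last test.
    · have := Nat.mul_le_mul_right (e.cost.eval V + 5) (hV p)
      simp only [cost, Polynomial.eval_add, Polynomial.eval_mul, Polynomial.eval_X,
        Polynomial.eval_ofNat]
      have e1 : 1 + (1 + (1 + (e.cost.eval V + 1))) + 1 = e.cost.eval V + 5 := by ring
      rw [e1]
      omega

open RamProg in
theorem Cmd.compile_reaches (c : Cmd) (d V : ℕ) (σ : RamState) (hV : ∀ v, σ.vars v ≤ V) :
    (c.compile d).Reaches (c.cost.eval V) σ fun τ =>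
      τ.mem = c.exec σ.vars σ.mem ∧ τ.vars = σ.vars ∧ ∀ i < d, τ.tmp i = σ.tmp i := by
  induction c generalizing d σ with
  | store a e =>
    refine Reaches.mono (.seq (T' := e.cost.eval V + 1) ((a.compile_reaches d V σ hV).mono le_rfl ?_))
      (by simp [cost, add_assoc]) fun _ => id
    rintro τ ⟨h1, h2, h3, h4⟩
    refine Reaches.seq ((e.compile_reaches (d + 1) V τ (by rwa [h2])).mono le_rfl ?_)
    rintro τ' ⟨h1', h2', h3', h4'⟩
    refine reaches_write _ _ ?_
    rw [RamState.reg_even, RamState.reg_even, h3', h4' d (by omega), h3, h1, h2]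
    exact ⟨by simp [h1, h1', exec], by simp [h2, h2'],
      fun i hi => by simp [h4' i (by omega), h4 i hi]⟩
  | seq c c' ih ih' =>
    refine Reaches.mono (.seq (T' := c'.cost.eval V) ((ih d σ hV).mono le_rfl ?_)) (by simp [cost]) fun _ => id
    rintro τ ⟨h1, h2, h4⟩
    refine (ih' d τ (by rwa [h2])).mono le_rfl ?_
    rintro τ' ⟨h1', h2', h4'⟩
    exact ⟨by rw [h1', h1, h2, exec], by rw [h2', h2], fun i hi => by rw [h4' i hi, h4 i hi]⟩
  | down v p c ih =>
    -- Executing the remaining `N` rounds on the current memory gives the final memory.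
    let J : ℕ → RamState → Prop := fun N τ =>
      iterDown (fun j m => c.exec (Function.update σ.vars v j) m) N τ.mem =
        (Cmd.down v p c).exec σ.vars σ.mem ∧
      N ≤ σ.vars p ∧ Function.update τ.vars v (σ.vars v) = σ.vars ∧
      τ.tmp d = N ∧ τ.tmp (d + 1) = σ.vars v ∧ ∀ i < d, τ.tmp i = σ.tmp i
    have step : ∀ N τ, J (N + 1) τ →
        (RamProg.seq (.const (2 * (d + 2)) 1) <| .seq (.sub (2 * d) (2 * d) (2 * (d + 2))) <|
          .seq (.copy (2 * v + 1) (2 * d)) (c.compile (d + 2))).Reaches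
          (1 + (1 + (1 + c.cost.eval V))) τ (J N) := by
      rintro N τ ⟨h1, h2, h3, h4, h5, h7⟩
      refine .seq (reaches_const _ _ (.seq (reaches_sub _ _ _ (.seq (reaches_copy _ _ ?_)))))
      simp only [RamState.reg_even]
      have hvars : Function.update τ.vars v N = Function.update σ.vars v N := by
        rw [← h3, Function.update_idem]
      set τ₁ := (((τ.setReg (2 * (d + 2)) 1).setReg (2 * d) _).setReg (2 * v + 1) _) with hτ₁
      have hv1 : τ₁.vars = Function.update σ.vars v N := by
        simp [hτ₁, h4, hvars]
      have ht1 : ∀ i ≠ d, i ≠ d + 2 → τ₁.tmp i = τ.tmp i := by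
        intro i hi hi'
        simp [hτ₁, hi, hi']
      have ht2 : τ₁.tmp d = N := by
        simp [hτ₁, h4]
      have hm1 : τ₁.mem = τ.mem := by simp [hτ₁]
      refine (ih (d + 2) τ₁ ?_).mono le_rfl ?_
      · intro w
        rw [hv1]
        by_cases hw : w = v
        · subst hw
          have := hV p
          rw [Function.update_self]
          omega
        · rw [Function.update_of_ne hw]
          exact hV w
      rintro τ' ⟨g1, g2, g4⟩
      refine ⟨?_, by omega, by simp [g2, hv1], ?_, ?_, fun i hi => ?_⟩
      · rw [← h1, g1, hv1, hm1]
        rfl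
      · rw [g4 _ (by omega), ht2]
      · rw [g4 _ (by omega), ht1 _ (by omega) (by omega), h5]
      · rw [g4 _ (by omega), ht1 _ (by omega) (by omega), h7 i hi]
    refine Reaches.mono (.seq (reaches_copy _ _ (.seq (reaches_copy _ _
      (.seq ((reaches_loop _ J (fun N τ h => h.2.2.2.1) step (σ.vars p) ?_).mono le_rfl
        fun τ h => reaches_copy _ _ ?_)))))) ?_ fun _ => id
    · refine ⟨rfl, le_rfl, by simp, by simp [RamState.reg_odd],
        by simp [RamState.reg_odd], fun i hi => ?_⟩
      simp only [RamState.tmp_setReg_even]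
      rw [Function.update_of_ne (by omega), Function.update_of_ne (by omega)]
    · obtain ⟨h1, -, h3, -, h5, h7⟩ := h
      refine ⟨by simpa [iterDown] using h1, by simp [RamState.reg_even, h5, h3], ?_⟩
      simpa using h7
    · have := Nat.mul_le_mul_right (c.cost.eval V + 4) (hV p)
      simp only [cost, Polynomial.eval_add, Polynomial.eval_mul, Polynomial.eval_X,
        Polynomial.eval_ofNat]
      have e1 : 1 + (1 + (1 + c.cost.eval V)) + 1 = c.cost.eval V + 4 := by ring
      rw [e1]
      omega

/-- The variables of a program that starts by reading two numbers. -/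
def initialVars (n k : ℕ) : ℕ → ℕ := Function.update (Function.update (fun _ => 0) 0 n) 1 k

open RamProg in
/-- What a command followed by an expression computes is computed in polynomial time. -/
theorem solvableInPolyTime_of_eval {ι : Type*} {input : ι → List ℕ} {size : ι → ℕ}
    {correct : ι → RamState → Prop} (c : Cmd) (e : Exp) (n k : ι → ℕ)
    (hn : ∀ x, (input x).getD 0 0 = n x) (hk : ∀ x, (input x).getD 1 0 = k x)
    (hsize : ∀ x, n x + k x ≤ size x)
    (h : ∀ x τ, τ.mem = c.exec (initialVars (n x) (k x)) (fun i => (input x).getD i 0) →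
      τ.reg 0 = e.eval (initialVars (n x) (k x)) τ.mem → correct x τ) :
    SolvableInPolyTime input size correct := by
  refine ⟨.seq (.const (2 * 0) 0) <| .seq (.read (2 * 0 + 1) (2 * 0)) <|
    .seq (.const (2 * 0) 1) <| .seq (.read (2 * 1 + 1) (2 * 0)) <|
    .seq (c.compile 0) (e.compile 0), 1 + (1 + (1 + (1 + (c.cost + e.cost)))), fun x => ?_⟩
  refine Reaches.mono (.seq (reaches_const _ _ (.seq (reaches_read _ _ (.seq (reaches_const _ _
    (.seq (reaches_read _ _ ?_)))))))) (T := 1 + (1 + (1 + (1 + (c.cost.eval (size x) +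
      e.cost.eval (size x)))))) (by simp) fun _ => id
  set σ := RamState.setReg _ (2 * 1 + 1) _ with hσ
  have hm : σ.mem = fun i => (input x).getD i 0 := rfl
  have hv : σ.vars = initialVars (n x) (k x) := by
    rw [hσ]
    simp only [RamState.vars_setReg_odd, RamState.vars_setReg_even, RamState.reg_even,
      RamState.tmp_setReg_even, RamState.tmp_setReg_odd, Function.update_self,
      RamState.mem_setReg]
    rw [initialVars, ← hn, ← hk]
    rfl
  -- The only nonzero variables are `n` and `k`, so the size bounds all of them and may be
  -- substituted into the cost polynomials.
  have hV : ∀ v, σ.vars v ≤ size x := by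
    intro v
    have := hsize x
    rw [hv]
    simp only [initialVars, Function.update_apply]
    split_ifs <;> omega
  refine .seq ((c.compile_reaches 0 _ σ hV).mono le_rfl ?_)
  rintro τ ⟨h1, h2, -⟩
  refine (e.compile_reaches 0 _ τ (by rwa [h2])).mono le_rfl ?_
  rintro τ' ⟨h1', h2', h3', -⟩
  refine h x τ' (by rw [h1', h1, hv, hm]) ?_
  rw [h1', ← hv, ← h2]
  exact h3'

/-! ### Derived expressions -/

namespace Exp

/-- The value of the expression does not depend on the variable `99`, which is used by
multiplications. -/
def Indep (e : Exp) : Prop :=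
  ∀ ρ j m, e.eval (Function.update ρ 99 j) m = e.eval ρ m

/-- The product of an expression and a variable. -/
def mulv (e : Exp) (v : ℕ) : Exp := .sum 99 v e

def not (a : Exp) : Exp := .ite a (.const 0) (.const 1)

def and (a b : Exp) : Exp := .ite a b (.const 0)

def imp (a b : Exp) : Exp := .ite a b (.const 1)

def eq (a b : Exp) : Exp := and (not (.sub a b)) (not (.sub b a))

/-- The truth value of `a ≠ 0`. -/
def truth (a : Exp) : Exp := .ite a (.const 1) (.const 0)

/-- For some value of `v` below `p`. -/
def ex (v p : ℕ) (e : Exp) : Exp := .sum v p e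

/-- For all values of `v` below `p`. -/
def all (v p : ℕ) (e : Exp) : Exp := not (ex v p (not e))

variable {a b e : Exp} {v p : ℕ} {ρ m : ℕ → ℕ}

@[simp] theorem eval_const (c : ℕ) : (const c).eval ρ m = c := rfl

@[simp] theorem eval_var : (var v).eval ρ m = ρ v := rfl

@[simp] theorem eval_add : (add a b).eval ρ m = a.eval ρ m + b.eval ρ m := rfl

@[simp] theorem eval_load : (load a).eval ρ m = m (a.eval ρ m) := rfl

@[simp] theorem indep_const (c : ℕ) : (const c).Indep := fun _ _ _ => rfl

@[simp] theorem indep_var (h : v ≠ 99) : (var v).Indep := fun _ _ _ => by simp [h]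

@[simp] theorem indep_add (ha : a.Indep) (hb : b.Indep) : (add a b).Indep :=
  fun ρ j m => by simp [ha ρ j m, hb ρ j m]

@[simp] theorem indep_load (ha : a.Indep) : (load a).Indep := fun ρ j m => by simp [ha ρ j m]

@[simp] theorem eval_mulv (he : e.Indep) : (mulv e v).eval ρ m = e.eval ρ m * ρ v := by
  simp [mulv, eval, he ρ _ m, mul_comm]

@[simp] theorem indep_mulv (he : e.Indep) (hv : v ≠ 99) : (mulv e v).Indep :=
  fun ρ j m => by simp [he, he ρ j m, hv]

-- Conditions count as true when nonzero, so that a sum is an existential quantifier; `truth`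
-- normalises the values that are stored or returned.
@[simp] theorem eval_not_ne_zero : (not a).eval ρ m ≠ 0 ↔ ¬ a.eval ρ m ≠ 0 := by
  simp only [not, eval]
  split_ifs <;> simp_all

@[simp] theorem eval_and_ne_zero :
    (and a b).eval ρ m ≠ 0 ↔ a.eval ρ m ≠ 0 ∧ b.eval ρ m ≠ 0 := by
  simp only [and, eval]
  split_ifs <;> simp_all

@[simp] theorem eval_imp_ne_zero :
    (imp a b).eval ρ m ≠ 0 ↔ (a.eval ρ m ≠ 0 → b.eval ρ m ≠ 0) := by
  simp only [imp, eval]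
  split_ifs <;> simp_all

@[simp] theorem eval_eq_ne_zero : (eq a b).eval ρ m ≠ 0 ↔ a.eval ρ m = b.eval ρ m := by
  simp only [eq, eval_and_ne_zero, eval_not_ne_zero, eval]
  omega

@[simp] theorem eval_ex_ne_zero :
    (ex v p e).eval ρ m ≠ 0 ↔ ∃ j < ρ p, e.eval (Function.update ρ v j) m ≠ 0 := by
  simp [ex, eval]

@[simp] theorem eval_all_ne_zero :
    (all v p e).eval ρ m ≠ 0 ↔ ∀ j < ρ p, e.eval (Function.update ρ v j) m ≠ 0 := by
  simp only [all, eval_not_ne_zero, eval_ex_ne_zero]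
  push Not
  rfl

theorem eval_ex_ne_zero_fin {n : ℕ} (h : ρ p = n) :
    (ex v p e).eval ρ m ≠ 0 ↔ ∃ j : Fin n, e.eval (Function.update ρ v j) m ≠ 0 := by
  rw [eval_ex_ne_zero, h]
  exact ⟨fun ⟨j, hj, h⟩ => ⟨⟨j, hj⟩, h⟩, fun ⟨j, h⟩ => ⟨j, j.2, h⟩⟩

theorem eval_all_ne_zero_fin {n : ℕ} (h : ρ p = n) :
    (all v p e).eval ρ m ≠ 0 ↔ ∀ j : Fin n, e.eval (Function.update ρ v j) m ≠ 0 := by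
  rw [eval_all_ne_zero, h]
  exact ⟨fun h j => h j j.2, fun h j hj => h ⟨j, hj⟩⟩

theorem isTruthValue_truth {P : Prop} (h : e.eval ρ m ≠ 0 ↔ P) :
    IsTruthValue ((truth e).eval ρ m) P := by
  simp only [IsTruthValue, truth, eval]
  exact ⟨fun hP => if_pos (h.2 hP), fun hP => if_neg fun hc => hP (h.1 hc)⟩

end Exp

theorem IsTruthValue.ne_zero_iff {v : ℕ} {P : Prop} (h : IsTruthValue v P) : v ≠ 0 ↔ P := by
  by_cases hP : P
  · simp [h.1 hP, hP]
  · simp [h.2 hP, hP]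

theorem iterDown_induction {α : Type*} {f : ℕ → α → α} {N : ℕ} (Q : ℕ → α → Prop)
    (h : ∀ j < N, ∀ x, Q (j + 1) x → Q j (f j x)) {x : α} (hx : Q N x) :
    Q 0 (iterDown f N x) := by
  induction N generalizing x with
  | zero => exact hx
  | succ N ih =>
    exact ih (fun j hj => h j (by omega)) (h N (by omega) _ hx)

/-! ### Addresses -/

/-- The number with the last four digits `b, c, x, y` in base `n`, after `t`. -/
def horner (n t b c x y : ℕ) : ℕ := (((t * n + b) * n + c) * n + x) * n + y

theorem digit_inj {n q q' d d' : ℕ} (hd : d < n) (hd' : d' < n)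
    (h : q * n + d = q' * n + d') : q = q' ∧ d = d' := by
  have hn : 0 < n := by omega
  have h1 := congrArg (· / n) h
  have h2 := congrArg (· % n) h
  simp only [Nat.mod_eq_of_lt, hd, hd', Nat.add_comm (_ * n),
    Nat.add_mul_div_right _ _ hn, Nat.div_eq_of_lt, zero_add, Nat.add_mul_mod_self_right] at h1 h2
  exact ⟨h1, h2⟩

theorem horner_inj {n t t' : ℕ} {b c x y b' c' x' y' : Fin n}
    (h : horner n t b c x y = horner n t' b' c' x' y') :
    t = t' ∧ b = b' ∧ c = c' ∧ x = x' ∧ y = y' := by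
  obtain ⟨h, h1⟩ := digit_inj y.2 y'.2 h
  obtain ⟨h, h2⟩ := digit_inj x.2 x'.2 h
  obtain ⟨h, h3⟩ := digit_inj c.2 c'.2 h
  obtain ⟨h, h4⟩ := digit_inj b.2 b'.2 h
  exact ⟨h, Fin.ext h4, Fin.ext h3, Fin.ext h2, Fin.ext h1⟩

theorem le_horner (n t b c x y : ℕ) : t * n ^ 4 ≤ horner n t b c x y := by
  have : horner n t b c x y = t * n ^ 4 + (b * n ^ 3 + c * n ^ 2 + x * n + y) := by
    simp only [horner]
    ring
  omega

theorem horner_lt {n : ℕ} (t : ℕ) (b c x y : Fin n) :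
    horner n t b c x y < (t + 1) * n ^ 4 := by
  have step : ∀ q d Q, d < n → q < Q → q * n + d < Q * n := by
    intro q d Q hd hq
    have := Nat.mul_le_mul_right n (Nat.succ_le_of_lt hq)
    rw [Nat.succ_mul] at this
    omega
  have := step _ _ _ y.2 (step _ _ _ x.2 (step _ _ _ c.2 (step _ _ _ b.2 (Nat.lt_succ_self t))))
  calc horner n t b c x y < _ := this
    _ = _ := by
      rw [Nat.succ_eq_add_one]
      ring

/-- Four nested loops over decreasing addresses. -/
theorem exec_down_four {n t : ℕ} {cmd : Cmd} {ρ : ℕ → ℕ} (hn : ρ 0 = n)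
    (P : ℕ → (ℕ → ℕ) → Prop)
    (h : ∀ (b c x y : Fin n) m, P (horner n t b c x y + 1) m →
      P (horner n t b c x y) (cmd.exec (Function.update (Function.update (Function.update
        (Function.update ρ 4 b) 5 c) 6 x) 7 y) m))
    {m : ℕ → ℕ} (hm : P ((t + 1) * n ^ 4) m) :
    P (t * n ^ 4) ((Cmd.down 4 0 (.down 5 0 (.down 6 0 (.down 7 0 cmd)))).exec ρ m) := by
  have key := iterDown_induction (N := ρ 0) (Q := fun j => P ((t * n + j) * n ^ 3))
    (f := fun j => (Cmd.down 5 0 (.down 6 0 (.down 7 0 cmd))).exec (Function.update ρ 4 j))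
    (fun b hb m hm => ?_) (x := m) (by convert hm using 1; rw [hn]; ring)
  · rw [show t * n ^ 4 = (t * n + 0) * n ^ 3 by ring]
    exact key
  have key := iterDown_induction (N := n) (Q := fun j => P (((t * n + b) * n + j) * n ^ 2))
    (f := fun j => (Cmd.down 6 0 (.down 7 0 cmd)).exec
      (Function.update (Function.update ρ 4 b) 5 j))
    (fun c hc m hm => ?_) (x := m) (by convert hm using 1; ring)
  · rw [show (t * n + b) * n ^ 3 = ((t * n + b) * n + 0) * n ^ 2 by ring]
    have e : Function.update ρ 4 b 0 = n := by simp [hn]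
    rw [Cmd.exec, e]
    exact key
  have key := iterDown_induction (N := n) (Q := fun j => P ((((t * n + b) * n + c) * n + j) * n))
    (f := fun j => (Cmd.down 7 0 cmd).exec
      (Function.update (Function.update (Function.update ρ 4 b) 5 c) 6 j))
    (fun x hx m hm => ?_) (x := m) (by convert hm using 1; ring)
  · rw [show ((t * n + b) * n + c) * n ^ 2 = (((t * n + b) * n + c) * n + 0) * n by ring]
    have e : Function.update (Function.update ρ 4 b) 5 c 0 = n := by simp [hn]
    rw [Cmd.exec, e]
    exact key
  have key := iterDown_induction (N := n)
    (Q := fun j => P ((((t * n + b) * n + c) * n + x) * n + j))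
    (f := fun j => cmd.exec
      (Function.update (Function.update (Function.update (Function.update ρ 4 b) 5 c) 6 x) 7 j))
    (fun y hy m hm => h ⟨b, hn ▸ hb⟩ ⟨c, hc⟩ ⟨x, hx⟩ ⟨y, hy⟩ m hm) (x := m)
    (by convert hm using 1; ring)
  have e : Function.update (Function.update (Function.update ρ 4 b) 5 c) 6 x 0 = n := by simp [hn]
  rw [Cmd.exec, e]
  exact key

/-! ### Tables of the squares of the graph of pairs -/

namespace AutomaticData

variable (I : AutomaticData)

/-- The memory contains the data in its first `4 + n * k + n` cells. -/
structure Stored (m : ℕ → ℕ) : Prop where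
  start : m 3 = I.s
  morphism : ∀ (b : Fin I.n) (j : ℕ) (c : Fin I.n), (I.φ b)[j]? = some c → m (4 + (b * I.k + j)) = c
  coding : ∀ b : Fin I.n, m (4 + (I.n * I.k + b)) = I.h b

theorem Stored.congr {I : AutomaticData} {m m' : ℕ → ℕ} (h : I.Stored m)
    (e : ∀ i < 4 + (I.n * I.k + I.n), m' i = m i) : I.Stored m' where
  start := by rw [e _ (by omega), h.start]
  morphism b j c hc := by
    have hj : j < I.k := by
      obtain ⟨h, -⟩ := List.getElem?_eq_some_iff.1 hc
      rwa [I.uniform] at h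
    have : (b + 1) * I.k ≤ I.n * I.k := Nat.mul_le_mul_right _ b.2
    rw [Nat.succ_mul] at this
    rw [e _ (by omega), h.morphism b j c hc]
  coding b := by rw [e _ (by omega), h.coding]

theorem length_input : I.input.length = 4 + (I.n * I.k + I.n) := by
  simp [input, List.length_flatMap, I.uniform]
  ring

theorem stored_input (w : List ℕ) : I.Stored fun i => (I.input ++ w).getD i 0 where
  start := by simp [input]
  morphism b j c hc := by
    have hj : j < I.k := by
      obtain ⟨h, -⟩ := List.getElem?_eq_some_iff.1 hc
      rwa [I.uniform] at h
    have hlen : ((List.finRange I.n).flatMap fun b => (I.φ b).map Fin.val).length =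
        I.n * I.k := by
      simp [List.length_flatMap, I.uniform]
    have : (b + 1) * I.k ≤ I.n * I.k := Nat.mul_le_mul_right _ b.2
    rw [Nat.succ_mul] at this
    simp only [input, List.append_assoc, List.getD_eq_getElem?_getD]
    rw [List.getElem?_append_right (by simp)]
    simp only [List.length_cons, List.length_nil, zero_add, Nat.reduceAdd,
      Nat.add_sub_cancel_left]
    rw [List.getElem?_append_left (by omega),
      getElem?_flatMap_of_uniform (K := I.k) (by simp [I.uniform]) _ _ _ hj]
    simp [hc]
  coding b := by
    have hlen : ([I.n, I.k, I.m, I.s] ++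
        (List.finRange I.n).flatMap fun b => (I.φ b).map Fin.val).length =
        4 + I.n * I.k := by
      simp [List.length_flatMap, I.uniform]
      omega
    simp only [input, List.getD_eq_getElem?_getD]
    rw [List.append_assoc, ← add_assoc, ← hlen, List.getElem?_append_right (by simp),
      Nat.add_sub_cancel_left, List.getElem?_append_left (by simp)]
    simp

theorem getD_input_append (w : List ℕ) (b : ℕ) :
    (I.input ++ w).getD (4 + (I.n * I.k + (I.n + b))) 0 = w.getD b 0 := by
  have := I.length_input
  rw [List.getD_eq_getElem?_getD, List.getElem?_append_right (by omega),
    List.getD_eq_getElem?_getD]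
  congr 2
  omega

/-- The address of the entry of the pairs `(b, c)` and `(x, y)` in the table number `t`. -/
def tableAddress (t b c x y : ℕ) : ℕ :=
  4 + (I.n * I.k + (I.n + I.n)) + horner I.n t b c x y

/-- `(x, y)` occurs among the pairs `(φ^l(b)(j), φ^l(c)(j))`. -/
def Edge (l : ℕ) (b c x y : Fin I.n) : Prop :=
  (x, y) ∈ iterMorphism (pairMorphism I.φ) l [(b, c)]

/-- All tables are correct from the relative address `a` on, and the memory below the tables is as
in `m₀`. -/
def Filled (m₀ : ℕ → ℕ) (a : ℕ) (m : ℕ → ℕ) : Prop :=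
  (∀ i < 4 + (I.n * I.k + (I.n + I.n)), m i = m₀ i) ∧
    ∀ t ≤ I.n * I.n, ∀ b c x y : Fin I.n, a ≤ horner I.n t b c x y →
      IsTruthValue (m (I.tableAddress t b c x y)) (I.Edge (2 ^ (I.n * I.n - t)) b c x y)

theorem Filled.update {I : AutomaticData} {m₀ m : ℕ → ℕ} {t : ℕ} {b c x y : Fin I.n}
    (h : I.Filled m₀ (horner I.n t b c x y + 1) m) {v : ℕ}
    (hv : IsTruthValue v (I.Edge (2 ^ (I.n * I.n - t)) b c x y)) :
    I.Filled m₀ (horner I.n t b c x y)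
      (Function.update m (I.tableAddress t b c x y) v) := by
  refine ⟨fun i hi => ?_, fun t' ht b' c' x' y' ha => ?_⟩
  · rw [Function.update_of_ne (by simp only [tableAddress]; omega), h.1 i hi]
  · rcases ha.lt_or_eq with hlt | heq
    · rw [Function.update_of_ne (by simp only [tableAddress]; omega)]
      exact h.2 t' ht b' c' x' y' hlt
    · obtain ⟨rfl, rfl, rfl, rfl, rfl⟩ := horner_inj heq
      rwa [Function.update_self]

end AutomaticData

/-! ### The program -/

/-- The address `4 + n * k + n + b`. -/
def setAddr (b : Exp) : Exp :=
  .add (.const 4) (.add (.mulv (.var 0) 1) (.add (.var 0) b))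

def tableAddr (t b c x y : Exp) : Exp :=
  .add (setAddr (.var 0)) <| .add (.mulv (.add (.mulv (.add (.mulv (.add (.mulv t 0) b) 0) c) 0)
    x) 0) y

/-- The letter `φ(b)(j)`. -/
def morphismLetter (b j : Exp) : Exp := .load (.add (.const 4) (.add (.mulv b 1) j))

/-- The letter `h(b)`. -/
def codingLetter (b : Exp) : Exp := .load (.add (.const 4) (.add (.mulv (.var 0) 1) b))

def fillTable (t e : Exp) : Cmd :=
  .down 4 0 (.down 5 0 (.down 6 0 (.down 7 0
    (.store (tableAddr t (.var 4) (.var 5) (.var 6) (.var 7)) (.truth e)))))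

/-- Fill the table number `n * n` with the graph of pairs, and then each table with the square of
the next one. -/
def fillTables : Cmd :=
  .seq
    (fillTable (.mulv (.var 0) 0) <| .ex 8 1 <|
      .and (.eq (morphismLetter (.var 4) (.var 8)) (.var 6))
        (.eq (morphismLetter (.var 5) (.var 8)) (.var 7)))
    (.down 2 0 <| .down 3 0 <|
      fillTable (.add (.mulv (.var 2) 0) (.var 3)) <| .ex 8 0 <| .ex 9 0 <|
        .and
          (.load (tableAddr (.add (.add (.mulv (.var 2) 0) (.var 3)) (.const 1))
            (.var 4) (.var 5) (.var 8) (.var 9)))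
          (.load (tableAddr (.add (.add (.mulv (.var 2) 0) (.var 3)) (.const 1))
            (.var 8) (.var 9) (.var 6) (.var 7))))

/-- The entry of the table number `0`. -/
def edgeExp (b c x y : Exp) : Exp := .load (tableAddr (.const 0) b c x y)

/-- Write the table of the letters `b` with `b ∼ s`. -/
def fillClass : Cmd :=
  .down 4 0 <| .store (setAddr (.var 4)) <| .truth <| .all 6 0 <| .all 7 0 <|
    .imp (edgeExp (.var 4) (.load (.const 3)) (.var 6) (.var 7))
      (.eq (codingLetter (.var 6)) (codingLetter (.var 7)))

/-- Some letter of the set occurs in the image of the letter `4`. -/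
def meetsExp : Exp :=
  .ex 5 0 <| .and (edgeExp (.var 4) (.var 4) (.var 5) (.var 5)) (.load (setAddr (.var 5)))

theorem eval_tableAddr (I : AutomaticData) {t b c x y : Exp} {ρ m : ℕ → ℕ} (hn : ρ 0 = I.n)
    (hk : ρ 1 = I.k) (ht : t.Indep) (hb : b.Indep) (hc : c.Indep) (hx : x.Indep) :
    (tableAddr t b c x y).eval ρ m =
      I.tableAddress (t.eval ρ m) (b.eval ρ m) (c.eval ρ m) (x.eval ρ m) (y.eval ρ m) := by
  have h1 : (Exp.add (.mulv t 0) b).Indep := by simp [ht, hb]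
  have h2 : (Exp.add (.mulv (.add (.mulv t 0) b) 0) c).Indep := by simp [h1, hc]
  have h3 : (Exp.add (.mulv (.add (.mulv (.add (.mulv t 0) b) 0) c) 0) x).Indep := by
    simp [h2, hx]
  simp [tableAddr, setAddr, AutomaticData.tableAddress, horner, ht, h1, h2, h3, hn, hk]

/-! ### Correctness of the tables -/

namespace AutomaticData

variable {I : AutomaticData} {m₀ m ρ : ℕ → ℕ}

theorem filled_fillTable {t : ℕ} {tE e : Exp} (hn : ρ 0 = I.n) (hk : ρ 1 = I.k)
    (hi : tE.Indep)
    (htE : ∀ b c x y m, tE.eval (Function.update (Function.update (Function.update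
        (Function.update ρ 4 b) 5 c) 6 x) 7 y) m = t)
    (he : ∀ (b c x y : Fin I.n) m, I.Filled m₀ ((t + 1) * I.n ^ 4) m →
      (e.eval (Function.update (Function.update (Function.update
        (Function.update ρ 4 b) 5 c) 6 x) 7 y) m ≠ 0 ↔
          I.Edge (2 ^ (I.n * I.n - t)) b c x y))
    (hm : I.Filled m₀ ((t + 1) * I.n ^ 4) m) :
    I.Filled m₀ (t * I.n ^ 4) ((fillTable tE e).exec ρ m) := by
  refine exec_down_four hn (I.Filled m₀) (fun b c x y m h => ?_) hm
  rw [Cmd.exec, eval_tableAddr I (by simpa using hn) (by simpa using hk) hi (by simp) (by simp)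
    (by simp), htE]
  -- While table `t` is being written, the tables after it remain complete, and these are all that
  -- the condition `e` may rely on.
  have h' : I.Filled m₀ ((t + 1) * I.n ^ 4) m :=
    ⟨h.1, fun t' ht' b' c' x' y' ha =>
      h.2 t' ht' b' c' x' y' ((Nat.succ_le_of_lt (horner_lt t b c x y)).trans ha)⟩
  have := h.update (Exp.isTruthValue_truth (he b c x y m h'))
  simpa using this

theorem edge_two_pow_succ_iff (l : ℕ) (b c x y : Fin I.n) :
    I.Edge (2 ^ (l + 1)) b c x y ↔ ∃ u v, I.Edge (2 ^ l) b c u v ∧ I.Edge (2 ^ l) u v x y := by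
  simp only [Edge]
  rw [pow_succ, mul_two, mem_iterMorphism_add]
  simp

theorem edge_one_iff (b c x y : Fin I.n) :
    I.Edge 1 b c x y ↔ ∃ j < I.k, (I.φ b)[j]? = some x ∧ (I.φ c)[j]? = some y := by
  rw [Edge, iterMorphism_one, pairMorphism, List.mem_iff_getElem?]
  simp only [List.getElem?_zip_eq_some]
  constructor
  · rintro ⟨j, h1, h2⟩
    obtain ⟨h, -⟩ := List.getElem?_eq_some_iff.1 h1
    exact ⟨j, by simpa [I.uniform] using h, h1, h2⟩
  · rintro ⟨j, -, h⟩
    exact ⟨j, h⟩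

theorem Stored.morphism_eq_iff (h : I.Stored m) (b x : Fin I.n) {j : ℕ} (hj : j < I.k) :
    m (4 + (b * I.k + j)) = x ↔ (I.φ b)[j]? = some x := by
  have hj' : j < (I.φ b).length := by rwa [I.uniform]
  rw [List.getElem?_eq_getElem hj', h.morphism b j _ (List.getElem?_eq_getElem hj'),
    Option.some_inj, Fin.val_inj]

/-- Table `n * n` has depth `1`, and each step to a smaller number doubles the depth, so table `0`
has depth `2^(n * n)`. Tables and entries are numbered so that loops running downwards complete the
addresses in decreasing order, which makes a single address enough for the invariant. -/
theorem filled_fillTables (hm : I.Stored m) (hn : ρ 0 = I.n) (hk : ρ 1 = I.k) :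
    I.Filled m 0 (fillTables.exec ρ m) := by
  -- Nothing is claimed yet: no entry of a table with number at most `n * n` has so large an
  -- address.
  have h0 : I.Filled m ((I.n * I.n + 1) * I.n ^ 4) m := by
    refine ⟨fun _ _ => rfl, fun t ht b c x y ha => absurd (horner_lt t b c x y) (not_lt.2 ?_)⟩
    exact (Nat.mul_le_mul_right _ (by omega)).trans ha
  have h1 := filled_fillTable (ρ := ρ) (tE := .mulv (.var 0) 0)
    (e := .ex 8 1 <|
      .and (.eq (morphismLetter (.var 4) (.var 8)) (.var 6))
        (.eq (morphismLetter (.var 5) (.var 8)) (.var 7))) hn hk (by simp) (by simp [hn])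
    (fun b c x y m' hm' => by
      have hs : I.Stored m' := hm.congr fun i hi => hm'.1 i (by omega)
      rw [Nat.sub_self, pow_zero, edge_one_iff]
      simp only [Exp.eval_ex_ne_zero, Exp.eval_and_ne_zero, Exp.eval_eq_ne_zero]
      refine exists_congr fun j => ?_
      simp only [ne_eq, not_false_eq_true, Function.update_of_ne, hk,
        OfNat.one_ne_ofNat]
      refine and_congr_right fun hj => ?_
      rw [← hs.morphism_eq_iff b x hj, ← hs.morphism_eq_iff c y hj]
      simp [morphismLetter, hk]) h0
  have h2 := iterDown_induction (N := ρ 0) (Q := fun i => I.Filled m (i * I.n * I.n ^ 4))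
    (f := fun i => (Cmd.down 3 0 <|
      fillTable (.add (.mulv (.var 2) 0) (.var 3)) <| .ex 8 0 <| .ex 9 0 <|
        .and
          (.load (tableAddr (.add (.add (.mulv (.var 2) 0) (.var 3)) (.const 1))
            (.var 4) (.var 5) (.var 8) (.var 9)))
          (.load (tableAddr (.add (.add (.mulv (.var 2) 0) (.var 3)) (.const 1))
            (.var 8) (.var 9) (.var 6) (.var 7)))).exec (Function.update ρ 2 i))
    (fun i hi m' hm' => ?_) (by rw [hn]; exact h1)
  · rwa [zero_mul, zero_mul] at h2
  rw [hn] at hi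
  have h3 := iterDown_induction (N := I.n) (Q := fun j => I.Filled m ((i * I.n + j) * I.n ^ 4))
    (f := fun j => (fillTable (.add (.mulv (.var 2) 0) (.var 3)) <| .ex 8 0 <| .ex 9 0 <|
        .and
          (.load (tableAddr (.add (.add (.mulv (.var 2) 0) (.var 3)) (.const 1))
            (.var 4) (.var 5) (.var 8) (.var 9)))
          (.load (tableAddr (.add (.add (.mulv (.var 2) 0) (.var 3)) (.const 1))
            (.var 8) (.var 9) (.var 6) (.var 7)))).exec
              (Function.update (Function.update ρ 2 i) 3 j))
    (fun j hj m' hm' => ?_) (x := m') (by convert hm' using 1; ring)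
  · simpa [Cmd.exec, hn] using h3
  have hq : (Exp.add (.mulv (.var 2) 0) (.var 3)).Indep := Exp.indep_add (by simp) (by simp)
  refine filled_fillTable (by simpa using hn) (by simpa using hk) hq (by simp [hn])
    (fun b c x y m'' hm'' => ?_) hm'
  have hlt : i * I.n + j < I.n * I.n := by
    have := Nat.mul_le_mul_right I.n (Nat.succ_le_of_lt hi)
    rw [Nat.succ_mul] at this
    omega
  have he : I.n * I.n - (i * I.n + j) = I.n * I.n - (i * I.n + j + 1) + 1 := by omega
  rw [he, edge_two_pow_succ_iff]
  have hT : ∀ b c x y : Fin I.n, m'' (I.tableAddress (i * I.n + j + 1) b c x y) ≠ 0 ↔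
      I.Edge (2 ^ (I.n * I.n - (i * I.n + j + 1))) b c x y := fun b c x y =>
    (hm''.2 _ hlt b c x y (le_horner _ _ _ _ _ _)).ne_zero_iff
  rw [Exp.eval_ex_ne_zero_fin (n := I.n) (by simpa using hn)]
  refine exists_congr fun u => ?_
  rw [Exp.eval_ex_ne_zero_fin (n := I.n) (by simpa using hn)]
  refine exists_congr fun v => ?_
  have hi : (Exp.add (.add (.mulv (.var 2) 0) (.var 3)) (.const 1)).Indep :=
    Exp.indep_add hq (by simp)
  rw [Exp.eval_and_ne_zero, Exp.eval_load, Exp.eval_load,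
    eval_tableAddr I (by simpa using hn) (by simpa using hk) hi (by simp) (by simp) (by simp),
    eval_tableAddr I (by simpa using hn) (by simpa using hk) hi (by simp) (by simp) (by simp),
    ← hT, ← hT]
  simp [hn]

/-- The data and the table number `0` are in the memory. -/
structure Ready (I : AutomaticData) (m : ℕ → ℕ) : Prop extends I.Stored m where
  table : ∀ b c x y : Fin I.n,
    m (I.tableAddress 0 b c x y) ≠ 0 ↔ I.Edge (2 ^ (I.n * I.n)) b c x y

theorem ready_fillTables (hm : I.Stored m) (hn : ρ 0 = I.n) (hk : ρ 1 = I.k) :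
    I.Ready (fillTables.exec ρ m) where
  toStored := hm.congr fun i hi => (filled_fillTables hm hn hk).1 i (by omega)
  table b c x y :=
    ((filled_fillTables hm hn hk).2 0 (Nat.zero_le _) b c x y (Nat.zero_le _)).ne_zero_iff

/-- The `n` cells left free, between the data and the tables, hold the set of letters under
consideration. -/
theorem Ready.congr {m' : ℕ → ℕ} (h : I.Ready m)
    (e : ∀ i, i < 4 + (I.n * I.k + I.n) ∨ 4 + (I.n * I.k + (I.n + I.n)) ≤ i → m' i = m i) :
    I.Ready m' where
  toStored := h.toStored.congr fun i hi => e i (.inl hi)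
  table b c x y := by
    rw [e _ (.inr (by simp only [tableAddress]; omega)), h.table]

theorem Ready.edge_iff (h : I.Ready m) (hn : ρ 0 = I.n) (hk : ρ 1 = I.k) {b c x y : Exp}
    (hb : b.Indep) (hc : c.Indep) (hx : x.Indep) {b' c' x' y' : Fin I.n}
    (eb : b.eval ρ m = b') (ec : c.eval ρ m = c') (ex : x.eval ρ m = x')
    (ey : y.eval ρ m = y') :
    (edgeExp b c x y).eval ρ m ≠ 0 ↔ I.Edge (2 ^ (I.n * I.n)) b' c' x' y' := by
  rw [edgeExp, Exp.eval_load, eval_tableAddr I hn hk (by simp) hb hc hx, eb, ec, ex, ey,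
    ← h.table]
  rfl

theorem ready_fillClass (hm : I.Ready m) (hn : ρ 0 = I.n) (hk : ρ 1 = I.k) :
    I.Ready (fillClass.exec ρ m) ∧ ∀ b : Fin I.n,
      IsTruthValue (fillClass.exec ρ m (4 + (I.n * I.k + (I.n + b))))
        (I.Sim (2 ^ (I.n * I.n)) b I.s) := by
  have key := iterDown_induction (N := ρ 0) (x := m)
    (Q := fun j m' => (∀ i, i < 4 + (I.n * I.k + I.n) ∨ 4 + (I.n * I.k + (I.n + I.n)) ≤ i →
        m' i = m i) ∧
      ∀ b : Fin I.n, j ≤ b → IsTruthValue (m' (4 + (I.n * I.k + (I.n + b))))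
        (I.Sim (2 ^ (I.n * I.n)) b I.s))
    (f := fun j => (Cmd.store (setAddr (.var 4)) <| .truth <| .all 6 0 <| .all 7 0 <|
      .imp (edgeExp (.var 4) (.load (.const 3)) (.var 6) (.var 7))
        (.eq (codingLetter (.var 6)) (codingLetter (.var 7)))).exec (Function.update ρ 4 j))
    (fun j hj m' hm' => ?_)
    ⟨fun _ _ => rfl, fun b hb => absurd b.2 (not_lt.2 (hn.symm.le.trans hb))⟩
  · exact ⟨hm.congr key.1, fun b => key.2 b (Nat.zero_le _)⟩
  rw [hn] at hj
  have hr := hm.congr hm'.1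
  have haddr : (setAddr (.var 4)).eval (Function.update ρ 4 j) m' =
      4 + (I.n * I.k + (I.n + j)) := by
    simp [setAddr, hn, hk]
  rw [Cmd.exec, haddr]
  refine ⟨fun i hi => ?_, fun b hb => ?_⟩
  · rw [Function.update_of_ne (by omega), hm'.1 i hi]
  rcases hb.lt_or_eq with hlt | rfl
  · rw [Function.update_of_ne (by omega)]
    exact hm'.2 b hlt
  rw [Function.update_self]
  refine Exp.isTruthValue_truth ?_
  rw [sim_iff]
  have hcode : ∀ v (ρ' : ℕ → ℕ) (x : Fin I.n), v ≠ 99 → ρ' 0 = I.n → ρ' 1 = I.k → ρ' v = x →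
      (codingLetter (.var v)).eval ρ' m' = I.h x := by
    intro v ρ' x _ h0 h1 hx
    simp [codingLetter, h0, h1, hx, hr.coding]
  have hiff : ∀ x y : Fin I.n, ((edgeExp (.var 4) (.load (.const 3)) (.var 6) (.var 7)).eval
        (Function.update (Function.update (Function.update ρ 4 b) 6 x) 7 y) m' ≠ 0 →
      (codingLetter (.var 6)).eval
        (Function.update (Function.update (Function.update ρ 4 b) 6 x) 7 y) m' =
      (codingLetter (.var 7)).eval
        (Function.update (Function.update (Function.update ρ 4 b) 6 x) 7 y) m') ↔
      (I.Edge (2 ^ (I.n * I.n)) b I.s x y → I.h x = I.h y) := by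
    intro x y
    rw [hr.edge_iff (b' := b) (c' := I.s) (x' := x) (y' := y) (by simpa using hn)
      (by simpa using hk) (by simp) (by simp) (by simp) (by simp) (by simpa using hr.start)
      (by simp) (by simp), hcode 6 _ x, hcode 7 _ y, Fin.val_inj] <;> simp [hn, hk]
  rw [Exp.eval_all_ne_zero_fin (n := I.n) (by simpa using hn), Prod.forall]
  refine forall_congr' fun x => ?_
  rw [Exp.eval_all_ne_zero_fin (n := I.n) (by simpa using hn)]
  refine forall_congr' fun y => ?_
  rw [Exp.eval_imp_ne_zero, Exp.eval_eq_ne_zero]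
  exact hiff x y

/-- Thanks to the diagonal, no separate table for the graph of letters is needed. -/
theorem edge_diag_iff (l : ℕ) (b c : Fin I.n) : I.Edge l b b c c ↔ c ∈ iterMorphism I.φ l [b] := by
  rw [Edge, mem_pair_diag]
  simp

/-- The set `H` is read from the cells between the data and the tables. A membership table given as
input is located there, and `fillClass` writes the class of `s` there, so the same expression serves
both problems. -/
theorem Ready.meets_iff (h : I.Ready m) (hn : ρ 0 = I.n) (hk : ρ 1 = I.k) {H : Set (Fin I.n)}
    (hH : ∀ b : Fin I.n, m (4 + (I.n * I.k + (I.n + b))) ≠ 0 ↔ b ∈ H) (b : Fin I.n) :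
    meetsExp.eval (Function.update ρ 4 b) m ≠ 0 ↔
      ∃ c ∈ iterMorphism I.φ (2 ^ (I.n * I.n)) [b], c ∈ H := by
  have hiff : ∀ c : Fin I.n, ((edgeExp (.var 4) (.var 4) (.var 5) (.var 5)).eval
      (Function.update (Function.update ρ 4 b) 5 c) m ≠ 0 ∧
      (Exp.load (setAddr (.var 5))).eval (Function.update (Function.update ρ 4 b) 5 c) m ≠ 0) ↔
      c ∈ iterMorphism I.φ (2 ^ (I.n * I.n)) [b] ∧ c ∈ H := by
    intro c
    rw [h.edge_iff (b' := b) (c' := b) (x' := c) (y' := c) (by simpa using hn)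
      (by simpa using hk) (by simp) (by simp) (by simp) (by simp) (by simp) (by simp)
      (by simp), edge_diag_iff, ← hH]
    simp [setAddr, hn, hk]
  simp only [← hiff]
  rw [meetsExp, Exp.eval_ex_ne_zero_fin (n := I.n) (by simpa using hn)]
  simp only [Exp.eval_and_ne_zero]

theorem two_pow_n_le : 2 ^ I.n ≤ 2 ^ (I.n * I.n) :=
  Nat.pow_le_pow_right two_pos (Nat.le_mul_self _)

end AutomaticData

/-! ### The polynomial-time algorithms -/

/-- An equivalence relation is a set of ordered pairs. The crude bound is a power of two, and hence
a depth reached by `n * n` squarings. -/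
theorem card_setoid_le (n : ℕ) : Nat.card (Setoid (Fin n)) ≤ 2 ^ (n * n) := by
  have := Nat.card_le_card_of_injective (fun s : Setoid (Fin n) => s.r) fun s t h =>
    Setoid.ext fun a b => iff_of_eq (congrFun (congrFun h a) b)
  simpa [Nat.card_fun, ← pow_mul] using this

theorem exists_solvable_sim :
    ∃ r : ℕ → ℕ, (∀ n, Nat.card (Setoid (Fin n)) ≤ 2 ^ r n) ∧
      SolvableInPolyTime (fun I : AutomaticData => I.input) (fun I => I.n + I.k)
        (fun I τ => ∀ b : Fin I.n,
          IsTruthValue (τ.mem (τ.reg 0 + b)) (I.Sim (2 ^ r I.n) b I.s)) := by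
  refine ⟨fun n => n * n, card_setoid_le, solvableInPolyTime_of_eval
    (.seq fillTables fillClass) (setAddr (.const 0)) (fun I => I.n) (fun I => I.k)
    (fun I => by simp [AutomaticData.input]) (fun I => by simp [AutomaticData.input])
    (fun I => le_rfl) fun I τ hm hr b => ?_⟩
  have h1 := I.stored_input []
  rw [List.append_nil] at h1
  have h2 := (AutomaticData.ready_fillClass (AutomaticData.ready_fillTables h1
    (ρ := initialVars I.n I.k) rfl rfl) (ρ := initialVars I.n I.k) rfl rfl).2 b
  have ha : (setAddr (.const 0)).eval (initialVars I.n I.k) τ.mem + b =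
      4 + (I.n * I.k + (I.n + b)) := by
    simp only [setAddr, Exp.eval_add, Exp.eval_const, Exp.eval_var, initialVars,
      Exp.eval_mulv (Exp.indep_var (v := 0) (by simp))]
    simp [add_assoc]
  rw [hr, ha, hm]
  exact h2

theorem solvable_eventuallyMeets :
    SolvableInPolyTime
      (fun x : (I : AutomaticData) × Finset (Fin I.n) => x.1.input ++ membershipTable x.2)
      (fun x => x.1.n + x.1.k)
      (fun x τ => IsTruthValue (τ.reg 0) (x.1.EventuallyMeets {c | c ∈ x.2})) := by
  refine solvableInPolyTime_of_eval fillTables (.truth (.all 4 0 meetsExp))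
    (fun x => x.1.n) (fun x => x.1.k)
    (fun x => by simp [AutomaticData.input]) (fun x => by simp [AutomaticData.input])
    (fun x => le_rfl) ?_
  rintro ⟨I, H⟩ τ hm hr
  have h1 := I.stored_input (membershipTable H)
  have h2 : I.Ready τ.mem := by
    rw [hm]
    exact AutomaticData.ready_fillTables h1 rfl rfl
  have hH : ∀ b : Fin I.n, τ.mem (4 + (I.n * I.k + (I.n + b))) ≠ 0 ↔
      b ∈ ({c | c ∈ H} : Set (Fin I.n)) := by
    intro b
    rw [hm, (AutomaticData.filled_fillTables h1 rfl rfl).1 _ (by have := b.2; omega)]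
    simp only [I.getD_input_append]
    simp [membershipTable, List.getD_eq_getElem?_getD]
  change IsTruthValue (τ.reg 0) _
  rw [hr]
  refine Exp.isTruthValue_truth ?_
  rw [I.eventuallyMeets_iff _ I.two_pow_n_le, Exp.eval_all_ne_zero_fin (n := I.n) rfl]
  simp only [← h2.meets_iff (ρ := initialVars I.n I.k) rfl rfl hH]

/-- Letters that do not occur in `φ^∞(s)` must not count, so the test is restricted to those
occurring in `φ^N(s)` with `N = 2^(n * n)`; they are read off from the diagonal entries in the row
of `s`. The same depth serves for `∼`, for the occurring letters and for meeting the class of `s`.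
-/
theorem solvable_almostPeriodic :
    SolvableInPolyTime (fun I : AutomaticData => I.input) (fun I => I.n + I.k)
      (fun I τ => IsTruthValue (τ.reg 0) (AlmostPeriodic I.sequence)) := by
  refine solvableInPolyTime_of_eval (.seq fillTables fillClass)
    (.truth (.all 4 0 (.imp (edgeExp (.load (.const 3)) (.load (.const 3)) (.var 4) (.var 4))
      meetsExp)))
    (fun I => I.n) (fun I => I.k)
    (fun I => by simp [AutomaticData.input]) (fun I => by simp [AutomaticData.input])
    (fun I => le_rfl) fun I τ hm hr => ?_
  have h1 := I.stored_input []
  rw [List.append_nil] at h1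
  obtain ⟨h2, h3⟩ := AutomaticData.ready_fillClass (AutomaticData.ready_fillTables h1
    (ρ := initialVars I.n I.k) rfl rfl) (ρ := initialVars I.n I.k) rfl rfl
  rw [Cmd.exec] at hm
  rw [← hm] at h2 h3
  rw [hr]
  refine Exp.isTruthValue_truth ?_
  rw [I.almostPeriodic_iff (card_setoid_le I.n),
    I.exists_meets_iff _ _ I.occurring_closed I.two_pow_n_le, Exp.eval_all_ne_zero_fin (n := I.n) rfl]
  simp only [Exp.eval_imp_ne_zero, I.mem_occurring_iff _ I.two_pow_n_le,
    ← AutomaticData.edge_diag_iff]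
  have hiff := h2.meets_iff (ρ := initialVars I.n I.k) rfl rfl
    (H := {c | I.Sim (2 ^ (I.n * I.n)) c I.s}) fun b => (h3 b).ne_zero_iff
  have hocc : ∀ b : Fin I.n,
      (edgeExp (.load (.const 3)) (.load (.const 3)) (.var 4) (.var 4)).eval
        (Function.update (initialVars I.n I.k) 4 b) τ.mem ≠ 0 ↔
      I.Edge (2 ^ (I.n * I.n)) I.s I.s b b := fun b =>
    h2.edge_iff rfl rfl (by simp) (by simp) (by simp) (by simpa using h2.start)
      (by simpa using h2.start) (by simp) (by simp)
  simp only [← AutomaticData.edge_diag_iff] at hiff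
  simp only [← hiff, ← hocc]

theorem mainTheorem3 :
    -- squaring the pair graph `i` times steps from `∼_l` to `∼_(l+2^i)`
    (∀ (I : AutomaticData) (i l : ℕ) (b c : Fin I.n), b ≠ c →
      (I.Sim (l + 2 ^ i) b c ↔
        ∀ x y : Fin I.n, squareGraph^[i] I.pairGraph s(b, c) s(x, y) → I.Sim l x y)) ∧
    -- squaring the morphism graph `i` times gives the graph of `φ^(2^i)`
    (∀ (I : AutomaticData) (i : ℕ) (b c : Fin I.n),
      squareGraph^[i] I.letterGraph b c ↔ c ∈ iterMorphism I.φ (2 ^ i) [b]) ∧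
    -- `n^2 + 1` squarings are enough to check the condition of the criterion
    (∀ (I : AutomaticData) (H : Set (Fin I.n)),
      I.EventuallyMeets H ↔ ∀ b, ∃ c ∈ H, squareGraph^[I.n ^ 2 + 1] I.letterGraph b c) ∧
    -- the criterion
    (∀ I : AutomaticData, I.AllLettersOccur →
      ∀ r : ℕ, Nat.card (Setoid (Fin I.n)) ≤ r →
        (AlmostPeriodic I.sequence ↔ I.EventuallyMeets {c | I.Sim r c I.s})) ∧
    -- the `∼_(2^r)`-class of `s` is computable in polynomial time, for some `r` with `2^r ≥ B_n`
    (∃ r : ℕ → ℕ, (∀ n, Nat.card (Setoid (Fin n)) ≤ 2 ^ r n) ∧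
      SolvableInPolyTime (fun I : AutomaticData => I.input) (fun I => I.n + I.k)
        (fun I τ => ∀ b : Fin I.n,
          IsTruthValue (τ.mem (τ.reg 0 + b)) (I.Sim (2 ^ r I.n) b I.s))) ∧
    -- given `H`, the condition of the criterion is decidable in polynomial time
    SolvableInPolyTime
      (fun x : (I : AutomaticData) × Finset (Fin I.n) => x.1.input ++ membershipTable x.2)
      (fun x => x.1.n + x.1.k)
      (fun x τ => IsTruthValue (τ.reg 0) (x.1.EventuallyMeets {c | c ∈ x.2})) ∧
    -- almost periodicity of automatic sequences is decidable in polynomial time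
    SolvableInPolyTime (fun I : AutomaticData => I.input) (fun I => I.n + I.k)
      (fun I τ => IsTruthValue (τ.reg 0) (AlmostPeriodic I.sequence)) := by
  refine ⟨fun I => I.sim_add_two_pow_iff, fun I i b c => squareGraph_iterate_iff I.φ i b c,
    fun I H => ?_, fun I h r hr => I.almostPeriodic_iff_eventuallyMeets h hr,
    exists_solvable_sim, solvable_eventuallyMeets, solvable_almostPeriodic⟩
  -- Any number of squarings that is at least `n` would do, as there are `2^n` sets of letters.
  rw [I.eventuallyMeets_iff H (N := 2 ^ (I.n ^ 2 + 1))
    (Nat.pow_le_pow_right two_pos (by nlinarith))]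
  have : ∀ b c, squareGraph^[I.n ^ 2 + 1] I.letterGraph b c ↔
      c ∈ iterMorphism I.φ (2 ^ (I.n ^ 2 + 1)) [b] :=
    fun b c => squareGraph_iterate_iff I.φ _ b c
  simp only [this, and_comm]
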